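/- **Theorem 7.1.** For complex $q$ with $|q|<1$ put $$E(q)=\prod_{n\ge1}(1-q^n),\qquad \varphi(q)=\sum_{n=-\infty}^{\infty}q^{n^2},\qquad \psi(q)=\sum_{n=-\infty}^{\infty}q^{2n^2-n}.$$ Then, for all complex $q$ with $|q|<1$, $$\varphi(-q)\varphi^3(-q^5)=\frac15\left(\frac{E^5(q)}{E(q^5)}+4\frac{E^5(q^2)}{E(q^{10})}\right)-\left(q\frac{E^5(q^5)}{E(q)}-4q^2\frac{E^5(q^{10})}{E(q^2)}\right),$$ $$\varphi^3(-q)\varphi(-q^5)=\frac15\left(\frac{E^5(q)}{E(q^5)}+4\frac{E^5(q^2)}{E(q^{10})}\right)-5\left(q\frac{E^5(q^5)}{E(q)}-4q^2\frac{E^5(q^{10})}{E(q^2)}\right),$$ $$4q\psi^3(q)\psi(q^5)=\frac15\left(\frac{E^5(q)}{E(q^5)}-\frac{E^5(q^2)}{E(q^{10})}\right)+5\left(q\frac{E^5(q^5)}{E(q)}+q^2\frac{E^5(q^{10})}{E(q^2)}\right),$$ $$4q^2\psi(q)\psi^3(q^5)=\frac15\left(\frac{E^5(q)}{E(q^5)}-\frac{E^5(q^2)}{E(q^{10})}\right)+\left(q\frac{E^5(q^5)}{E(q)}+q^2\frac{E^5(q^{10})}{E(q^2)}\right).$$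 Furthermore, let $a(n),b(n),c(n),d(n)$ $(n\ge1)$ be defined by the power series expansions, for $|q|<1$, $$\varphi(q)\varphi^3(q^5)=1+\sum_{n\ge1}a(n)q^n,\qquad \varphi^3(q)\varphi(q^5)=1+\sum_{n\ge1}b(n)q^n,$$ $$4q\psi^3(q)\psi(q^5)=\sum_{n\ge1}c(n)q^n,\qquad 4q^2\psi(q)\psi^3(q^5)=\sum_{n\ge1}d(n)q^n.$$ These expansions exist, and their coefficients count representations: $a(n)$ and $b(n)$ are the numbers of $(x,y,z,w)\in\mathbb Z^4$ with $x^2+5(y^2+z^2+w^2)=n$ and with $5x^2+y^2+z^2+w^2=n$, respectively; $c(n)$ and $d(n)$ are $4$ times the numbers of quadruples $(x,y,z,w)$ of triangular numbers $0,1,3,6,\dots$ with $5x+y+z+w=n-1$ and with $x+5(y+z+w)=n-2$, respectively. For every $n\ge1$ with prime factorization $$n=2^g5^{h}\prod_{i=1}^r p_i^{v_i}\prod_{j=1}^s q_j^{w_j},\qquad p_i\equiv\pm1\!\!\pmod 5,\quad q_j\equiv\pm2\!\!\pmod 5,\ q_j\text{ odd},$$ let $t=w_1+\dots+w_s$ be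 the number of odd prime divisors of $n$, counted with multiplicity, that are congruent to $\pm2$ modulo $5$, and let $$\Pi(n)=\prod_{i=1}^r\frac{1-p_i^{v_i+1}}{1-p_i}\prod_{j=1}^s\frac{1-(-q_j)^{w_j+1}}{1+q_j}.$$ Then $$a(n)=(-1)^{n-1}\bigl(1+5^{h}(-1)^{g+t}\bigr)\frac{5+(-2)^{g+1}}{3}\,\Pi(n),$$ $$b(n)=(-1)^{n-1}\bigl(1+5^{h+1}(-1)^{g+t}\bigr)\frac{5+(-2)^{g+1}}{3}\,\Pi(n),$$ $$c(n)=(-2)^g\bigl(-1+5^{h+1}(-1)^{g+t}\bigr)\,\Pi(n),$$ $$d(n)=(-2)^g\bigl(-1+5^{h}(-1)^{g+t}\bigr)\,\Pi(n).$$ -/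

import Mathlib

noncomputable section

/-- The infinite `q`-shifted factorial `(a; q)_∞ = ∏_{n ≥ 0} (1 - a qⁿ)`. -/
def qPochhammerInf (a q : ℂ) : ℂ := ∏' n : ℕ, (1 - a * q ^ n)

/-- `E(q) = (q; q)_∞ = ∏_{n ≥ 1} (1 - qⁿ)`. -/
def eulerE (q : ℂ) : ℂ := qPochhammerInf q q

/-- Ramanujan's general theta function
`f(a, b) = ∑_{n ∈ ℤ} a ^ (n (n + 1) / 2) b ^ (n (n - 1) / 2)`, for `|a b| < 1`.
Both divisions are exact and both exponents are nonnegative. -/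
def ramanujanF (a b : ℂ) : ℂ :=
  ∑' n : ℤ, a ^ (n * (n + 1) / 2) * b ^ (n * (n - 1) / 2)

/-- `φ(q) = f(q, q) = ∑_{n ∈ ℤ} q ^ (n²)`. -/
def ramanujanPhi (q : ℂ) : ℂ := ramanujanF q q

/-- `ψ(q) = f(q, q³) = ∑_{n ∈ ℤ} q ^ (2 n² - n)`. -/
def ramanujanPsi (q : ℂ) : ℂ := ramanujanF q (q ^ 3)

/-- The number of `(x, y, z, w) ∈ ℤ⁴` with `k x² + l (y² + z² + w²) = n`. -/
def quaternaryCount (k l : ℤ) (n : ℕ) : ℕ :=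
  Set.ncard {v : ℤ × ℤ × ℤ × ℤ |
    k * v.1 ^ 2 + l * (v.2.1 ^ 2 + v.2.2.1 ^ 2 + v.2.2.2 ^ 2) = n}

/-- `m` is a triangular number `0, 1, 3, 6, 10, …`. -/
def IsTriangularNumber (m : ℕ) : Prop := ∃ k : ℕ, m = k * (k + 1) / 2

/-- The number of quadruples `(x, y, z, w)` of triangular numbers with
`k x + l (y + z + w) + s = n`, that is, `k x + l (y + z + w) = n - s`. -/
def triangularCount (k l s n : ℕ) : ℕ :=
  Set.ncard {v : ℕ × ℕ × ℕ × ℕ |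
    IsTriangularNumber v.1 ∧ IsTriangularNumber v.2.1 ∧
    IsTriangularNumber v.2.2.1 ∧ IsTriangularNumber v.2.2.2 ∧
    k * v.1 + l * (v.2.1 + v.2.2.1 + v.2.2.2) + s = n}

/-- The prime divisors `p` of `n` with `p ≡ ± 1 (mod 5)`. -/
def primesOne (n : ℕ) : Finset ℕ :=
  n.primeFactors.filter fun p => p % 5 = 1 ∨ p % 5 = 4

/-- The odd prime divisors `p` of `n` with `p ≡ ± 2 (mod 5)`. -/
def primesTwo (n : ℕ) : Finset ℕ :=
  n.primeFactors.filter fun p => p ≠ 2 ∧ (p % 5 = 2 ∨ p % 5 = 3)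

/-- The number of odd prime divisors of `n` that are `≡ ± 2 (mod 5)`,
counted with multiplicity. -/
def primesTwoOmega (n : ℕ) : ℕ := ∑ p ∈ primesTwo n, n.factorization p

/-- `∏_i (1 - p_i ^ (v_i + 1)) / (1 - p_i) · ∏_j (1 - (-q_j) ^ (w_j + 1)) / (1 + q_j)`,
where `n = 2 ^ g 5 ^ d ∏_i p_i ^ v_i ∏_j q_j ^ w_j` is the prime factorization, with
`p_i ≡ ± 1 (mod 5)` and `q_j` odd, `q_j ≡ ± 2 (mod 5)`. -/
def primesProd (n : ℕ) : ℂ :=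
  (∏ p ∈ primesOne n, (1 - (p : ℂ) ^ (n.factorization p + 1)) / (1 - (p : ℂ))) *
  ∏ p ∈ primesTwo n, (1 - (-(p : ℂ)) ^ (n.factorization p + 1)) / (1 + (p : ℂ))

end

/-!
By Jacobi's triple product, `φ(-q) = E(q)² / E(q²)` and `ψ(q) = E(q²)² / E(q)`. Splitting the double
series `φ²` and `ψ²` along the tiling of `ℤ²` by crosses of five points gives the two relations
`φ(q)² - φ(q⁵)² = 4 q f(q, q⁹) f(q³, q⁷)` and `ψ(q)² - q ψ(q⁵)² = f(q, q⁴) f(q², q³)`, whose right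
sides are again eta quotients; the four theta identities are rational consequences of these two.

The Weierstrass function of the torus `ℂˣ / q^ℤ` satisfies
`℘(x) - ℘(y) = -E(q)⁶ y θ(x y) θ(x / y) / (θ(x) θ(y))²`. At the points `ζ, ζ²` of order `5`, and at
`q, q²` on the torus `ℂˣ / q^{5ℤ}`, the right side collapses to constant multiples of
`E(q)⁵ / E(q⁵)` and `q E(q⁵)⁵ / E(q)`, while the left side is a Lambert series. So the coefficients
of these eta quotients come from `∑_{d ∣ n} χ(d) d` and `∑_{d ∣ n} χ(n / d) d` for the quadratic
character `χ` modulo `5`; these are multiplicative, and the coefficient formulas follow by the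
uniqueness of power series.
-/

open Filter Topology

/-! ### Infinite `q`-shifted factorials -/

section QPochhammer

variable {a q : ℂ}

lemma norm_pow_lt_one (hq : ‖q‖ < 1) {m : ℕ} (hm : m ≠ 0) : ‖q ^ m‖ < 1 := by
  simpa only [norm_pow] using pow_lt_one₀ (norm_nonneg q) hq hm

lemma summable_norm_mul_pow (a : ℂ) (hq : ‖q‖ < 1) : Summable fun n : ℕ => ‖-(a * q ^ n)‖ := by
  simpa only [norm_neg, norm_mul, norm_pow] using
    (summable_geometric_of_lt_one (norm_nonneg q) hq).mul_left ‖a‖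

lemma hasProd_qPochhammerInf (a : ℂ) (hq : ‖q‖ < 1) :
    HasProd (fun n : ℕ => 1 - a * q ^ n) (qPochhammerInf a q) := by
  have h := multipliable_one_add_of_summable (summable_norm_mul_pow a hq)
  simp only [← sub_eq_add_neg] at h
  exact h.hasProd

lemma qPochhammerInf_ne_zero (hq : ‖q‖ < 1) (h : ∀ n : ℕ, a * q ^ n ≠ 1) :
    qPochhammerInf a q ≠ 0 := by
  simpa only [qPochhammerInf, sub_eq_add_neg] using
    tprod_one_add_ne_zero_of_summable (f := fun n : ℕ => -(a * q ^ n))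
      (fun n => by simpa only [← sub_eq_add_neg] using sub_ne_zero.mpr (h n).symm)
      (summable_norm_mul_pow a hq)

lemma qPochhammerInf_ne_zero_of_norm_lt_one (hq : ‖q‖ < 1) (ha : ‖a‖ < 1) :
    qPochhammerInf a q ≠ 0 := by
  refine qPochhammerInf_ne_zero hq fun n h => ?_
  have hlt : ‖a * q ^ n‖ < 1 := by
    rw [norm_mul, norm_pow]
    exact mul_lt_one_of_nonneg_of_lt_one_left (norm_nonneg a) ha
      (pow_le_one₀ (norm_nonneg q) hq.le)
  rw [h, norm_one] at hlt
  exact lt_irrefl 1 hlt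

lemma eulerE_ne_zero (hq : ‖q‖ < 1) : eulerE q ≠ 0 :=
  qPochhammerInf_ne_zero_of_norm_lt_one hq hq

lemma eulerE_zero : eulerE 0 = 1 := by
  simp [eulerE, qPochhammerInf]

lemma qPochhammerInf_eq_one_sub_mul (a : ℂ) (hq : ‖q‖ < 1) :
    qPochhammerInf a q = (1 - a) * qPochhammerInf (a * q) q := by
  have htail : HasProd (fun n : ℕ => 1 - a * q ^ (n + 1)) (qPochhammerInf (a * q) q) :=
    (hasProd_qPochhammerInf (a * q) hq).congr_fun fun n => by ring
  simpa using (hasProd_qPochhammerInf a hq).unique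
    (htail.zero_mul (f := fun n : ℕ => 1 - a * q ^ n))

lemma qPochhammerInf_eq_prod_residues (a : ℂ) (hq : ‖q‖ < 1) (m : ℕ) [NeZero m] :
    qPochhammerInf a q = ∏ j : Fin m, qPochhammerInf (a * q ^ (j : ℕ)) (q ^ m) := by
  have h := ((((Equiv.prodComm _ _).trans (Nat.divModEquiv m).symm).hasProd_iff
    (f := fun n : ℕ => 1 - a * q ^ n)).mpr (hasProd_qPochhammerInf a hq)).prod_fiberwise
    (g := fun j : Fin m => qPochhammerInf (a * q ^ (j : ℕ)) (q ^ m)) fun j =>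
      (hasProd_qPochhammerInf (a * q ^ (j : ℕ)) (norm_pow_lt_one hq (NeZero.ne m))).congr_fun
        fun n => by
          simp only [Function.comp_apply, Equiv.trans_apply, Equiv.prodComm_apply, Prod.swap,
            Nat.divModEquiv, Equiv.coe_fn_symm_mk, pow_add, pow_mul']
          ring
  exact h.unique (hasProd_fintype _)

lemma prod_qPochhammerInf_rootsOfUnity {ζ : ℂ} {m : ℕ} (hζ : IsPrimitiveRoot ζ m) (hm : 0 < m)
    (a : ℂ) (hq : ‖q‖ < 1) :
    ∏ j ∈ Finset.range m, qPochhammerInf (ζ ^ j * a) q = qPochhammerInf (a ^ m) (q ^ m) := by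
  have hroots (y : ℂ) : ∏ j ∈ Finset.range m, (1 - ζ ^ j * y) = 1 - y ^ m := by
    simpa [Polynomial.eval_prod] using
      (congrArg (Polynomial.eval 1) (X_pow_sub_C_eq_prod hζ hm (rfl : y ^ m = y ^ m))).symm
  refine (hasProd_prod fun j _ => hasProd_qPochhammerInf (ζ ^ j * a) hq).unique ?_
  refine (hasProd_qPochhammerInf (a ^ m) (norm_pow_lt_one hq hm.ne')).congr_fun fun n => ?_
  rw [← pow_mul, mul_comm m n, pow_mul, ← mul_pow, ← hroots]
  exact Finset.prod_congr rfl fun j _ => by ring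

lemma qPochhammerInf_mul_neg (a : ℂ) (hq : ‖q‖ < 1) :
    qPochhammerInf a q * qPochhammerInf (-a) q = qPochhammerInf (a ^ 2) (q ^ 2) := by
  simpa [Finset.prod_range_succ] using
    prod_qPochhammerInf_rootsOfUnity (IsPrimitiveRoot.neg_one 0 (by norm_num)) two_pos a hq

end QPochhammer

/-! ### The Jacobi triple product -/

/-- The integer `n (n - 1) / 2`, for `n ∈ ℤ`; the division is exact. -/
def tri (n : ℤ) : ℤ := n * (n - 1) / 2

lemma two_mul_tri (n : ℤ) : 2 * tri n = n * (n - 1) :=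
  Int.mul_ediv_cancel' (Int.even_mul_pred_self n).two_dvd

lemma tri_zero : tri 0 = 0 := rfl

lemma tri_add_one (n : ℤ) : tri (n + 1) = tri n + n := by
  linarith [two_mul_tri (n + 1), two_mul_tri n]

/-- The coefficients `(-1)ⁿ q^{n (n - 1) / 2}` of the theta function `theta`. -/
noncomputable def thetaCoeff (q : ℂ) (n : ℤ) : ℂ := (-1) ^ n * q ^ tri n

/-- The theta function `∑_{n ∈ ℤ} (-1)ⁿ q^{n (n - 1) / 2} xⁿ`, written multiplicatively. -/
noncomputable def theta (x q : ℂ) : ℂ := ∑' n : ℤ, thetaCoeff q n * x ^ n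

/-- The finite `q`-shifted factorial `(q; q)_N`. -/
noncomputable def qFactorial (q : ℂ) (N : ℕ) : ℂ := ∏ i ∈ Finset.range N, (1 - q * q ^ i)

/-- The reciprocal of `(q; q)_m`, extended by zero to negative integers `m`. -/
noncomputable def qFactorialRecip (q : ℂ) (m : ℤ) : ℂ :=
  if m < 0 then 0 else (qFactorial q m.toNat)⁻¹

/-- The terms of the finite Jacobi triple product: `(-1)ⁿ q^{n (n - 1) / 2} xⁿ` times the
`q`-binomial coefficient `(q; q)_{2N} / ((q; q)_{N - n} (q; q)_{N + n})`. -/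
noncomputable def tripleTerm (x q : ℂ) (N : ℕ) (n : ℤ) : ℂ :=
  qFactorial q (2 * N) * (thetaCoeff q n * x ^ n) *
    (qFactorialRecip q (N - n) * qFactorialRecip q (N + n))

section TripleProduct

variable {q x : ℂ}

open Real in
lemma summable_norm_theta (hq₀ : q ≠ 0) (hq : ‖q‖ < 1) (hx : x ≠ 0) :
    Summable fun n : ℤ => ‖thetaCoeff q n * x ^ n‖ := by
  have him : 0 < (Complex.log q / (2 * π * Complex.I)).im := by
    have hlog : Real.log ‖q‖ < 0 := Real.log_neg (norm_pos_iff.mpr hq₀) hq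
    have : Complex.log q / (2 * π * Complex.I) =
        -(Complex.I * Complex.log q) / ((2 * π : ℝ) : ℂ) := by
      push_cast
      field_simp
      rw [Complex.I_sq]
      ring
    rw [this, Complex.div_ofReal_im, Complex.neg_im, Complex.I_mul_im, Complex.log_re]
    exact div_pos (neg_pos.mpr hlog) two_pi_pos
  refine (((summable_jacobiTheta₂_term_iff
    ((Complex.log x - Complex.log q / 2) / (2 * π * Complex.I)) _).mpr him).norm).congr fun n => ?_
  have htri : (tri n : ℂ) = n * (n - 1) / 2 := by
    rw [eq_div_iff two_ne_zero, mul_comm]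
    exact_mod_cast two_mul_tri n
  have hterm : jacobiTheta₂_term n ((Complex.log x - Complex.log q / 2) / (2 * π * Complex.I))
      (Complex.log q / (2 * π * Complex.I)) = q ^ tri n * x ^ n := by
    rw [← Complex.cpow_intCast, ← Complex.cpow_intCast, Complex.cpow_def_of_ne_zero hq₀,
      Complex.cpow_def_of_ne_zero hx, ← Complex.exp_add, jacobiTheta₂_term, htri]
    congr 1
    field_simp
    ring
  simp [hterm, thetaCoeff]

lemma qFactorialRecip_sub_one (hq : ‖q‖ < 1) (m : ℤ) :
    qFactorialRecip q (m - 1) = (1 - q ^ m) * qFactorialRecip q m := by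
  unfold qFactorialRecip
  rcases lt_trichotomy m 0 with h | rfl | h
  · rw [if_pos (by lia), if_pos h, mul_zero]
  · simp
  · obtain ⟨k, rfl⟩ : ∃ k : ℕ, m = k + 1 := ⟨(m - 1).toNat, by lia⟩
    have hk : q ^ ((k : ℤ) + 1) = q * q ^ k := by rw [← pow_succ']; exact_mod_cast rfl
    have hne : 1 - q * q ^ k ≠ 0 := by
      rw [← pow_succ', sub_ne_zero]
      intro h
      simpa [← h] using norm_pow_lt_one hq k.succ_ne_zero
    rw [if_neg (by lia), if_neg (by lia), show ((k : ℤ) + 1 - 1).toNat = k by lia,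
      show ((k : ℤ) + 1).toNat = k + 1 by lia, qFactorial, qFactorial, Finset.prod_range_succ, hk]
    field_simp

lemma qFactorial_two_mul_succ (q : ℂ) (N : ℕ) :
    qFactorial q (2 * (N + 1)) =
      qFactorial q (2 * N) * ((1 - q * (q ^ N) ^ 2) * (1 - q ^ 2 * (q ^ N) ^ 2)) := by
  rw [show 2 * (N + 1) = 2 * N + 1 + 1 by ring, qFactorial, qFactorial, Finset.prod_range_succ,
    Finset.prod_range_succ]
  ring

lemma thetaCoeff_mul_zpow_add_one (hq₀ : q ≠ 0) (hx : x ≠ 0) (n : ℤ) :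
    thetaCoeff q (n + 1) * x ^ (n + 1) = -(q ^ n * x) * (thetaCoeff q n * x ^ n) := by
  rw [thetaCoeff, thetaCoeff, tri_add_one, zpow_add₀ hq₀, zpow_add_one₀ hx,
    zpow_add_one₀ (by norm_num)]
  ring

lemma tripleTerm_succ (hq₀ : q ≠ 0) (hq : ‖q‖ < 1) (hx : x ≠ 0) (N : ℕ) (n : ℤ) :
    tripleTerm x q (N + 1) n = (1 + q * (q ^ N) ^ 2) * tripleTerm x q N n -
      q ^ N * x * tripleTerm x q N (n - 1) - q ^ N * q / x * tripleTerm x q N (n + 1) := by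
  have hsub (k : ℤ) : qFactorialRecip q (N - k) =
      (1 - q ^ N * q / q ^ k) * qFactorialRecip q ((N + 1 : ℕ) - k) := by
    rw [show (N : ℤ) - k = ((N + 1 : ℕ) - k) - 1 by push_cast; ring,
      qFactorialRecip_sub_one hq, zpow_sub₀ hq₀, zpow_natCast, pow_succ]
  have hadd (k : ℤ) : qFactorialRecip q (N + k) =
      (1 - q ^ N * q * q ^ k) * qFactorialRecip q ((N + 1 : ℕ) + k) := by
    rw [show (N : ℤ) + k = ((N + 1 : ℕ) + k) - 1 by push_cast; ring,
      qFactorialRecip_sub_one hq, zpow_add₀ hq₀, zpow_natCast, pow_succ]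
  have hprev := thetaCoeff_mul_zpow_add_one hq₀ hx (n - 1)
  rw [sub_add_cancel, zpow_sub_one₀ hq₀] at hprev
  have hsub' : ((N + 1 : ℕ) : ℤ) - (n + 1) = N - n := by push_cast; ring
  have hadd' : ((N + 1 : ℕ) : ℤ) + (n - 1) = N + n := by push_cast; ring
  simp only [tripleTerm, qFactorial_two_mul_succ, thetaCoeff_mul_zpow_add_one hq₀ hx n]
  rw [hsub (n + 1), hadd (n - 1), hsub', hadd', hsub n, hadd n,
    show (N : ℤ) - (n - 1) = (N + 1 : ℕ) - n by push_cast; ring,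
    show (N : ℤ) + (n + 1) = (N + 1 : ℕ) + n by push_cast; ring,
    hprev, zpow_add_one₀ hq₀, zpow_sub_one₀ hq₀]
  have hn : q ^ n ≠ 0 := zpow_ne_zero n hq₀
  field_simp
  ring

lemma hasSum_tripleTerm (hq₀ : q ≠ 0) (hq : ‖q‖ < 1) (hx : x ≠ 0) (N : ℕ) :
    HasSum (tripleTerm x q N) (∏ i ∈ Finset.range N, (1 - x * q ^ i) * (1 - q / x * q ^ i)) := by
  induction N with
  | zero =>
    have hsupp (n : ℤ) (hn : n ≠ 0) : tripleTerm x q 0 n = 0 := by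
      rcases hn.lt_or_gt with h | h <;> simp [tripleTerm, qFactorialRecip, h]
    simpa [tripleTerm, qFactorialRecip, qFactorial, thetaCoeff, tri_zero] using
      hasSum_single 0 hsupp
  | succ N ih =>
    have hprev := ((Equiv.subRight (1 : ℤ)).hasSum_iff).mpr ih
    have hnext := ((Equiv.addRight (1 : ℤ)).hasSum_iff).mpr ih
    have h := (((ih.mul_left (1 + q * (q ^ N) ^ 2)).sub (hprev.mul_left (q ^ N * x))).sub
      (hnext.mul_left (q ^ N * q / x))).congr_fun (tripleTerm_succ hq₀ hq hx N)
    rw [← sub_mul, ← sub_mul] at h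
    have hfactor : 1 + q * (q ^ N) ^ 2 - q ^ N * x - q ^ N * q / x =
        (1 - x * q ^ N) * (1 - q / x * q ^ N) := by
      field_simp
      ring
    rwa [Finset.prod_range_succ, mul_comm, ← hfactor]

lemma tendsto_qFactorial (hq : ‖q‖ < 1) : Tendsto (qFactorial q) atTop (𝓝 (eulerE q)) :=
  (hasProd_qPochhammerInf q hq).tendsto_prod_nat

lemma tendsto_qFactorialRecip (hq : ‖q‖ < 1) (n : ℤ) :
    Tendsto (fun N : ℕ => qFactorialRecip q (N + n)) atTop (𝓝 (eulerE q)⁻¹) := by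
  have hidx : Tendsto (fun N : ℕ => ((N : ℤ) + n).toNat) atTop atTop :=
    tendsto_atTop.mpr fun b => by
      filter_upwards [eventually_ge_atTop (b + n.natAbs)] with N hN
      lia
  refine (((tendsto_qFactorial hq).inv₀ (eulerE_ne_zero hq)).comp hidx).congr' ?_
  filter_upwards [eventually_ge_atTop n.natAbs] with N hN
  exact (if_neg (by lia)).symm

lemma exists_norm_qFactorial_le (hq : ‖q‖ < 1) : ∃ C, ∀ N, ‖qFactorial q N‖ ≤ C := by
  obtain ⟨C, hC⟩ := (tendsto_qFactorial hq).norm.bddAbove_range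
  exact ⟨C, fun N => hC ⟨N, rfl⟩⟩

lemma exists_norm_qFactorialRecip_le (hq : ‖q‖ < 1) : ∃ D, ∀ m, ‖qFactorialRecip q m‖ ≤ D := by
  obtain ⟨D, hD⟩ := ((tendsto_qFactorial hq).inv₀ (eulerE_ne_zero hq)).norm.bddAbove_range
  refine ⟨D, fun m => ?_⟩
  unfold qFactorialRecip
  split_ifs
  · simpa using (norm_nonneg _).trans (hD ⟨0, rfl⟩)
  · exact hD ⟨_, rfl⟩

theorem theta_eq_prod (hq₀ : q ≠ 0) (hq : ‖q‖ < 1) (hx : x ≠ 0) :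
    theta x q = eulerE q * (qPochhammerInf x q * qPochhammerInf (q / x) q) := by
  obtain ⟨C, hC⟩ := exists_norm_qFactorial_le hq
  obtain ⟨D, hD⟩ := exists_norm_qFactorialRecip_le hq
  have hC₀ : 0 ≤ C := (norm_nonneg _).trans (hC 0)
  have hD₀ : 0 ≤ D := (norm_nonneg _).trans (hD 0)
  have hterm (n : ℤ) : Tendsto (tripleTerm x q · n) atTop
      (𝓝 (eulerE q * (thetaCoeff q n * x ^ n) * ((eulerE q)⁻¹ * (eulerE q)⁻¹))) := by
    refine Tendsto.mul (Tendsto.mul_const _ ?_) (.mul ?_ (tendsto_qFactorialRecip hq n))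
    · exact (tendsto_qFactorial hq).comp (tendsto_id.const_mul_atTop' two_pos)
    · simpa only [sub_eq_add_neg] using tendsto_qFactorialRecip hq (-n)
  have hbound (N : ℕ) (n : ℤ) :
      ‖tripleTerm x q N n‖ ≤ C * ‖thetaCoeff q n * x ^ n‖ * (D * D) := by
    rw [tripleTerm, norm_mul, norm_mul, norm_mul (qFactorialRecip q _)]
    gcongr
    exacts [hC _, hD _, hD _]
  have hlim := tendsto_tsum_of_dominated_convergence
    (((summable_norm_theta hq₀ hq hx).mul_left C).mul_right (D * D)) hterm
    (Eventually.of_forall hbound)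
  simp only [(hasSum_tripleTerm hq₀ hq hx _).tsum_eq] at hlim
  have hprod := tendsto_nhds_unique hlim ((hasProd_qPochhammerInf x hq).mul
    (hasProd_qPochhammerInf (q / x) hq)).tendsto_prod_nat
  rw [tsum_mul_right, tsum_mul_left] at hprod
  have hE := eulerE_ne_zero hq
  rw [← hprod, theta]
  field_simp

end TripleProduct

/-! ### Theta functions in powers of `q` and their quintic dissections -/

/-- The series `∑_{n ∈ ℤ} q^{A n (n - 1) / 2 + c n} = f(q^c, q^{A - c})`. -/
noncomputable def thetaPow (q : ℂ) (A : ℕ) (c : ℤ) : ℂ := ∑' n : ℤ, q ^ (A * tri n + c * n)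

/-- The origin of `ℤ²` and its four neighbours. The translates of this cross by the sublattice
spanned by `(2, 1)` and `(-1, 2)` tile `ℤ²`, and `crossPoint j` lies in the coset
`x - 2 y ≡ j (mod 5)`. -/
def crossPoint : Fin 5 → ℤ × ℤ := ![(0, 0), (1, 0), (0, -1), (0, 1), (-1, 0)]

/-- The tiling of `ℤ²` by translates of `crossPoint`. -/
def crossTiling : Fin 5 × (ℤ × ℤ) ≃ ℤ × ℤ where
  toFun p := (2 * p.2.1 - p.2.2 + (crossPoint p.1).1, p.2.1 + 2 * p.2.2 + (crossPoint p.1).2)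
  invFun v :=
    let j : Fin 5 := ⟨((v.1 - 2 * v.2) % 5).toNat, by lia⟩
    (j, (2 * (v.1 - (crossPoint j).1) + (v.2 - (crossPoint j).2)) / 5,
      (2 * (v.2 - (crossPoint j).2) - (v.1 - (crossPoint j).1)) / 5)
  left_inv := by
    rintro ⟨j, m, n⟩
    have hj : (⟨((2 * m - n + (crossPoint j).1 - 2 * (m + 2 * n + (crossPoint j).2)) % 5).toNat,
        by lia⟩ : Fin 5) = j := by
      ext
      fin_cases j <;> simp [crossPoint] <;> lia
    simp only [hj, Prod.mk.injEq, true_and]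
    constructor <;> lia
  right_inv := by
    rintro ⟨x, y⟩
    have hj (j : Fin 5) (h : j.val = ((x - 2 * y) % 5).toNat) :
        (x - (crossPoint j).1 - 2 * (y - (crossPoint j).2)) % 5 = 0 := by
      fin_cases j <;> simp [crossPoint] at h ⊢ <;> lia
    have := hj ⟨((x - 2 * y) % 5).toNat, by lia⟩ rfl
    simp only [Prod.mk.injEq]
    constructor <;> lia

section ThetaPow

variable {q : ℂ}

lemma zpow_mul_tri_add (hq₀ : q ≠ 0) (A : ℕ) (c n : ℤ) :
    q ^ (A * tri n + c * n) = thetaCoeff (q ^ A) n * (-q ^ c) ^ n := by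
  have hsign : (-1 : ℂ) ^ n * (-1) ^ n = 1 := by rw [← mul_zpow]; simp
  rw [thetaCoeff, zpow_add₀ hq₀, zpow_mul, zpow_mul, zpow_natCast, neg_eq_neg_one_mul (q ^ c),
    mul_zpow]
  linear_combination (-(q ^ A) ^ tri n * (q ^ c) ^ n) * hsign

lemma summable_norm_thetaPow (hq₀ : q ≠ 0) (hq : ‖q‖ < 1) {A : ℕ} (hA : A ≠ 0) (c : ℤ) :
    Summable fun n : ℤ => ‖q ^ (A * tri n + c * n)‖ := by
  simpa only [zpow_mul_tri_add hq₀] using summable_norm_theta (pow_ne_zero A hq₀)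
    (norm_pow_lt_one hq hA) (neg_ne_zero.mpr (zpow_ne_zero c hq₀))

lemma thetaPow_eq_prod (hq₀ : q ≠ 0) (hq : ‖q‖ < 1) {A : ℕ} (hA : A ≠ 0) (c : ℤ) :
    thetaPow q A c = eulerE (q ^ A) *
      (qPochhammerInf (-q ^ c) (q ^ A) * qPochhammerInf (-q ^ (A - c)) (q ^ A)) := by
  have htheta : thetaPow q A c = theta (-q ^ c) (q ^ A) :=
    tsum_congr (zpow_mul_tri_add hq₀ A c)
  rw [htheta, theta_eq_prod (pow_ne_zero A hq₀) (norm_pow_lt_one hq hA)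
    (neg_ne_zero.mpr (zpow_ne_zero c hq₀)), zpow_sub₀ hq₀, zpow_natCast, div_neg]

lemma thetaPow_eq_zpow_mul_add (hq₀ : q ≠ 0) (A : ℕ) (c : ℤ) :
    thetaPow q A c = q ^ c * thetaPow q A (A + c) := by
  rw [thetaPow, ← (Equiv.addRight (1 : ℤ)).tsum_eq, thetaPow, ← tsum_mul_left]
  refine tsum_congr fun n => ?_
  rw [← zpow_add₀ hq₀, Equiv.coe_addRight, tri_add_one]
  ring_nf

lemma thetaPow_eq_zpow_mul_neg (hq₀ : q ≠ 0) (A : ℕ) (c : ℤ) :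
    thetaPow q A c = q ^ c * thetaPow q A (-c) := by
  rw [thetaPow, ← (Equiv.subLeft (1 : ℤ)).tsum_eq, thetaPow, ← tsum_mul_left]
  refine tsum_congr fun n => ?_
  have htri : tri (1 - n) = tri n := by linarith [two_mul_tri (1 - n), two_mul_tri n]
  rw [← zpow_add₀ hq₀, Equiv.subLeft_apply, htri]
  ring_nf

lemma thetaPow_sub (hq₀ : q ≠ 0) (A : ℕ) (c : ℤ) : thetaPow q A (A - c) = thetaPow q A c := by
  rw [thetaPow_eq_zpow_mul_neg hq₀ A c, thetaPow_eq_zpow_mul_add hq₀ A (-c), ← mul_assoc,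
    ← zpow_add₀ hq₀, add_neg_cancel, zpow_zero, one_mul, sub_eq_add_neg]

lemma thetaPow_pow (q : ℂ) (k A : ℕ) (c : ℤ) :
    thetaPow (q ^ k) A c = thetaPow q (k * A) (k * c) := by
  refine tsum_congr fun n => ?_
  rw [← zpow_natCast q k, ← zpow_mul]
  push_cast
  ring_nf

lemma thetaPow_mul_thetaPow (hq₀ : q ≠ 0) (hq : ‖q‖ < 1) {A : ℕ} (hA : A ≠ 0) (c c' : ℤ) :
    thetaPow q A c * thetaPow q A c' =
      ∑ j, q ^ (A * (tri (crossPoint j).1 + tri (crossPoint j).2) +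
          c * (crossPoint j).1 + c' * (crossPoint j).2) *
        (thetaPow q (5 * A) (A * (2 * (crossPoint j).1 + (crossPoint j).2 + 1) + 2 * c + c') *
          thetaPow q (5 * A)
            (A * (2 * (crossPoint j).2 - (crossPoint j).1 + 2) + 2 * c' - c)) := by
  have hs := summable_norm_thetaPow hq₀ hq hA
  have hs' := summable_norm_thetaPow hq₀ hq (mul_ne_zero (by norm_num : 5 ≠ 0) hA)
  have hF := summable_mul_of_summable_norm (hs c) (hs c')
  rw [thetaPow, thetaPow, tsum_mul_tsum_of_summable_norm (hs c) (hs c'), ← crossTiling.tsum_eq]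
  refine (crossTiling.summable_iff.mpr hF).tsum_prod.trans ?_
  rw [tsum_fintype]
  refine Finset.sum_congr rfl fun j _ => ?_
  rw [thetaPow, thetaPow, tsum_mul_tsum_of_summable_norm (hs' _) (hs' _), ← tsum_mul_left]
  refine tsum_congr fun ⟨m, n⟩ => ?_
  simp only [crossTiling, Equiv.coe_fn_mk, ← zpow_add₀ hq₀]
  refine congrArg (q ^ ·) ?_
  have hx := two_mul_tri (2 * m - n + (crossPoint j).1)
  have hy := two_mul_tri (m + 2 * n + (crossPoint j).2)
  have hm := two_mul_tri m
  have hn := two_mul_tri n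
  have ha := two_mul_tri (crossPoint j).1
  have hb := two_mul_tri (crossPoint j).2
  push_cast
  refine mul_left_cancel₀ (two_ne_zero (α := ℤ)) ?_
  linear_combination A * (hx + hy - 5 * hm - 5 * hn - ha - hb)

lemma crossPoint_apply : crossPoint 0 = (0, 0) ∧ crossPoint 1 = (1, 0) ∧
    crossPoint 2 = (0, -1) ∧ crossPoint 3 = (0, 1) ∧ crossPoint 4 = (-1, 0) :=
  ⟨rfl, rfl, rfl, rfl, rfl⟩

lemma thetaPow_two_one_sq (hq₀ : q ≠ 0) (hq : ‖q‖ < 1) :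
    thetaPow q 2 1 ^ 2 = thetaPow q 10 5 ^ 2 + 4 * q * (thetaPow q 10 1 * thetaPow q 10 3) := by
  have h9 : thetaPow q 10 9 = thetaPow q 10 1 := thetaPow_sub hq₀ 10 1
  have h7 : thetaPow q 10 7 = thetaPow q 10 3 := thetaPow_sub hq₀ 10 3
  rw [sq, thetaPow_mul_thetaPow hq₀ hq two_ne_zero, Fin.sum_univ_five]
  norm_num [crossPoint_apply, tri, h9, h7]
  ring

lemma thetaPow_one_zero_sq (hq₀ : q ≠ 0) (hq : ‖q‖ < 1) :
    thetaPow q 1 0 ^ 2 = q * thetaPow q 5 0 ^ 2 + 4 * (thetaPow q 5 1 * thetaPow q 5 2) := by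
  have hshift : thetaPow q 1 0 = q * thetaPow q 1 (-1) := by
    rw [thetaPow_eq_zpow_mul_add hq₀ 1 (-1), zpow_neg_one, mul_inv_cancel_left₀ hq₀]
    norm_num
  have h1 : thetaPow q 5 1 = q * thetaPow q 5 (-1) := by
    simpa using thetaPow_eq_zpow_mul_neg hq₀ 5 1
  have h2 : thetaPow q 5 2 = q ^ 2 * thetaPow q 5 (-2) := thetaPow_eq_zpow_mul_neg hq₀ 5 2
  have h3 : thetaPow q 5 3 = thetaPow q 5 2 := thetaPow_sub hq₀ 5 2
  have h4 : thetaPow q 5 4 = thetaPow q 5 1 := thetaPow_sub hq₀ 5 1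
  nth_rw 1 [sq]
  nth_rw 2 [hshift]
  rw [mul_left_comm, thetaPow_mul_thetaPow hq₀ hq one_ne_zero, Fin.sum_univ_five]
  norm_num [crossPoint_apply, tri, h3, h4]
  rw [h1, h2]
  field_simp
  ring

end ThetaPow

/-! ### Product formulas for `φ` and `ψ` -/

section Products

variable {q : ℂ}

lemma eulerE_pow_ne_zero (hq : ‖q‖ < 1) {k : ℕ} (hk : k ≠ 0) : eulerE (q ^ k) ≠ 0 :=
  eulerE_ne_zero (norm_pow_lt_one hq hk)

lemma qPochhammerInf_neg_self (hq : ‖q‖ < 1) :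
    qPochhammerInf (-q) q = eulerE (q ^ 2) / eulerE q := by
  rw [eq_div_iff (eulerE_ne_zero hq), mul_comm]
  exact qPochhammerInf_mul_neg q hq

lemma qPochhammerInf_self_sq (hq : ‖q‖ < 1) :
    qPochhammerInf q (q ^ 2) = eulerE q / eulerE (q ^ 2) := by
  rw [eq_div_iff (eulerE_pow_ne_zero hq two_ne_zero), eulerE, eulerE,
    qPochhammerInf_eq_prod_residues q hq 2]
  simp [Fin.prod_univ_two, sq]

lemma mul_add_one_ediv_two (n : ℤ) : n * (n + 1) / 2 = tri n + n := by
  rw [← tri_add_one, tri, add_sub_cancel_right, mul_comm]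

lemma ramanujanPhi_eq_thetaPow (hq₀ : q ≠ 0) : ramanujanPhi q = thetaPow q 2 1 := by
  refine tsum_congr fun n => ?_
  rw [mul_add_one_ediv_two, ← tri, ← zpow_add₀ hq₀]
  push_cast
  ring_nf

lemma ramanujanPsi_eq_thetaPow (hq₀ : q ≠ 0) : ramanujanPsi q = thetaPow q 4 1 := by
  refine tsum_congr fun n => ?_
  rw [mul_add_one_ediv_two, ← tri, ← zpow_natCast q 3, ← zpow_mul, ← zpow_add₀ hq₀]
  push_cast
  ring_nf

lemma ramanujanF_zero_zero : ramanujanF 0 0 = 1 := by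
  rw [ramanujanF, tsum_eq_single 0 fun n hn => ?_]
  · simp
  rw [mul_add_one_ediv_two, ← tri]
  by_cases htri : tri n = 0
  · rw [htri, zero_add, zero_zpow n hn, zero_mul]
  · rw [zero_zpow _ htri, mul_zero]

lemma ramanujanPhi_zero : ramanujanPhi 0 = 1 := ramanujanF_zero_zero

lemma ramanujanPsi_zero : ramanujanPsi 0 = 1 := by
  rw [ramanujanPsi, zero_pow three_ne_zero, ramanujanF_zero_zero]

lemma ramanujanPhi_neg (hq : ‖q‖ < 1) : ramanujanPhi (-q) = eulerE q ^ 2 / eulerE (q ^ 2) := by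
  rcases eq_or_ne q 0 with rfl | hq₀
  · simp [ramanujanPhi_zero, eulerE_zero]
  have h2 := eulerE_pow_ne_zero hq two_ne_zero
  rw [ramanujanPhi_eq_thetaPow (neg_ne_zero.mpr hq₀),
    thetaPow_eq_prod (neg_ne_zero.mpr hq₀) (by rwa [norm_neg]) two_ne_zero]
  norm_num [qPochhammerInf_self_sq hq]
  field_simp

lemma ramanujanPsi_eq_prod (hq : ‖q‖ < 1) : ramanujanPsi q = eulerE (q ^ 2) ^ 2 / eulerE q := by
  rcases eq_or_ne q 0 with rfl | hq₀
  · simp [ramanujanPsi_zero, eulerE_zero]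
  have h1 := eulerE_ne_zero hq
  have h2 := eulerE_pow_ne_zero hq two_ne_zero
  have h4 := eulerE_pow_ne_zero hq four_ne_zero
  have hq2 := norm_pow_lt_one hq two_ne_zero
  have hodd := qPochhammerInf_mul_neg q hq2
  rw [qPochhammerInf_self_sq hq, qPochhammerInf_self_sq hq2,
    qPochhammerInf_eq_prod_residues (-q) hq2 2] at hodd
  simp only [Fin.prod_univ_two, ← pow_mul, ← pow_succ', neg_mul] at hodd
  norm_num at hodd
  rw [ramanujanPsi_eq_thetaPow hq₀, thetaPow_eq_prod hq₀ hq four_ne_zero]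
  norm_num [zpow_ofNat]
  field_simp at hodd ⊢
  linear_combination hodd

lemma thetaPow_one_zero (hq₀ : q ≠ 0) (hq : ‖q‖ < 1) :
    thetaPow q 1 0 = 2 * (eulerE (q ^ 2) ^ 2 / eulerE q) := by
  have h1 := eulerE_ne_zero hq
  rw [thetaPow_eq_prod hq₀ hq one_ne_zero]
  norm_num
  rw [qPochhammerInf_eq_one_sub_mul (-1) hq, neg_one_mul, qPochhammerInf_neg_self hq]
  field_simp
  ring

lemma eulerE_psi_relation (hq : ‖q‖ < 1) :
    eulerE (q ^ 2) ^ 4 / eulerE q ^ 2 - q * (eulerE (q ^ 10) ^ 4 / eulerE (q ^ 5) ^ 2) =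
      eulerE (q ^ 5) ^ 3 * eulerE (q ^ 2) / (eulerE (q ^ 10) * eulerE q) := by
  rcases eq_or_ne q 0 with rfl | hq₀
  · simp [eulerE_zero]
  have h1 := eulerE_ne_zero hq
  have h5 := eulerE_pow_ne_zero hq (k := 5) (by norm_num)
  have h10 := eulerE_pow_ne_zero hq (k := 10) (by norm_num)
  have hq5 := norm_pow_lt_one hq (m := 5) (by norm_num)
  have hprod : thetaPow q 5 1 * thetaPow q 5 2 =
      eulerE (q ^ 5) ^ 3 * eulerE (q ^ 2) / (eulerE (q ^ 10) * eulerE q) := by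
    have hres := qPochhammerInf_eq_prod_residues (-q) hq 5
    simp only [Fin.prod_univ_five, neg_mul, ← pow_succ', qPochhammerInf_neg_self hq] at hres
    norm_num [qPochhammerInf_neg_self hq5, ← pow_mul] at hres
    rw [thetaPow_eq_prod hq₀ hq (by norm_num), thetaPow_eq_prod hq₀ hq (by norm_num)]
    norm_num [zpow_ofNat]
    field_simp at hres ⊢
    linear_combination -hres
  have hfive : thetaPow q 5 0 = 2 * (eulerE (q ^ 10) ^ 2 / eulerE (q ^ 5)) := by
    simpa [← pow_mul, thetaPow_one_zero (pow_ne_zero 5 hq₀) hq5] using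
      (thetaPow_pow q 5 1 0).symm
  have hsq := thetaPow_one_zero_sq hq₀ hq
  rw [hprod, hfive, thetaPow_one_zero hq₀ hq] at hsq
  linear_combination hsq / 4

lemma eulerE_phi_relation (hq : ‖q‖ < 1) :
    eulerE (q ^ 5) ^ 4 / eulerE (q ^ 10) ^ 2 - eulerE q ^ 4 / eulerE (q ^ 2) ^ 2 =
      4 * q * (eulerE q * eulerE (q ^ 10) ^ 3 / (eulerE (q ^ 2) * eulerE (q ^ 5))) := by
  rcases eq_or_ne q 0 with rfl | hq₀
  · simp [eulerE_zero]
  have h2 := eulerE_pow_ne_zero hq two_ne_zero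
  have h5 := eulerE_pow_ne_zero hq (k := 5) (by norm_num)
  have h10 := eulerE_pow_ne_zero hq (k := 10) (by norm_num)
  have hq2 := norm_pow_lt_one hq two_ne_zero
  have hq5 := norm_pow_lt_one hq (m := 5) (by norm_num)
  have hneg₀ := neg_ne_zero.mpr hq₀
  have hneg : ‖-q‖ < 1 := by rwa [norm_neg]
  have hprod : thetaPow (-q) 10 1 * thetaPow (-q) 10 3 =
      eulerE q * eulerE (q ^ 10) ^ 3 / (eulerE (q ^ 2) * eulerE (q ^ 5)) := by
    have hres := qPochhammerInf_eq_prod_residues q hq2 5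
    have hodd := qPochhammerInf_self_sq hq5
    simp only [Fin.prod_univ_five, ← pow_mul, ← pow_succ', qPochhammerInf_self_sq hq] at hres hodd
    norm_num [hodd] at hres
    rw [thetaPow_eq_prod hneg₀ hneg (by norm_num), thetaPow_eq_prod hneg₀ hneg (by norm_num)]
    norm_num [zpow_ofNat, Odd.neg_pow, Nat.odd_iff]
    field_simp at hres ⊢
    linear_combination -hres
  have hfive : thetaPow (-q) 10 5 = eulerE (q ^ 5) ^ 2 / eulerE (q ^ 10) := by
    have h := ramanujanPhi_neg hq5
    rw [ramanujanPhi_eq_thetaPow (neg_ne_zero.mpr (pow_ne_zero 5 hq₀)),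
      ← Odd.neg_pow (by decide), thetaPow_pow] at h
    simpa [← pow_mul] using h
  have hsq := thetaPow_two_one_sq hneg₀ hneg
  rw [hprod, hfive, ← ramanujanPhi_eq_thetaPow hneg₀, ramanujanPhi_neg hq] at hsq
  linear_combination -hsq

end Products

/-! ### The four theta function identities -/

section RationalIdentities

variable {K : Type*} [Field K] {q e₁ e₂ e₅ e₁₀ : K}

lemma phi_identities_of_relations (h₁ : e₁ ≠ 0) (h₂ : e₂ ≠ 0) (h₅ : e₅ ≠ 0) (h₁₀ : e₁₀ ≠ 0)
    (hfive : (5 : K) ≠ 0)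
    (hpsi : e₂ ^ 4 / e₁ ^ 2 - q * (e₁₀ ^ 4 / e₅ ^ 2) = e₅ ^ 3 * e₂ / (e₁₀ * e₁))
    (hphi : e₅ ^ 4 / e₁₀ ^ 2 - e₁ ^ 4 / e₂ ^ 2 = 4 * q * (e₁ * e₁₀ ^ 3 / (e₂ * e₅))) :
    e₁ ^ 2 / e₂ * (e₅ ^ 2 / e₁₀) ^ 3 =
        (e₁ ^ 5 / e₅ + 4 * (e₂ ^ 5 / e₁₀)) / 5 -
          (q * (e₅ ^ 5 / e₁) - 4 * q ^ 2 * (e₁₀ ^ 5 / e₂)) ∧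
      (e₁ ^ 2 / e₂) ^ 3 * (e₅ ^ 2 / e₁₀) =
        (e₁ ^ 5 / e₅ + 4 * (e₂ ^ 5 / e₁₀)) / 5 -
          5 * (q * (e₅ ^ 5 / e₁) - 4 * q ^ 2 * (e₁₀ ^ 5 / e₂)) := by
  have hsum : (e₁ ^ 5 / e₅ + 4 * (e₂ ^ 5 / e₁₀)) / 5 = e₁ * e₂ ^ 2 * e₅ ^ 3 / e₁₀ ^ 2 := by
    linear_combination (norm := field_simp)
      (4 * (e₁ ^ 2 * e₂ / e₁₀) * hpsi - e₁ * e₂ ^ 2 / e₅ * hphi) / 5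
    ring
  have hdiff : q * (e₅ ^ 5 / e₁) - 4 * q ^ 2 * (e₁₀ ^ 5 / e₂) =
      q * (e₁ ^ 3 * e₅ * e₁₀ ^ 2 / e₂ ^ 2) := by
    field_simp at hphi ⊢
    linear_combination q * hphi
  have hone : e₁ ^ 2 / e₂ * (e₅ ^ 2 / e₁₀) ^ 3 =
      e₁ * e₂ ^ 2 * e₅ ^ 3 / e₁₀ ^ 2 - q * (e₁ ^ 3 * e₅ * e₁₀ ^ 2 / e₂ ^ 2) := by
    field_simp at hpsi ⊢
    linear_combination -hpsi
  have hthree : (e₁ ^ 2 / e₂) ^ 3 * (e₅ ^ 2 / e₁₀) =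
      e₁ ^ 2 / e₂ * (e₅ ^ 2 / e₁₀) ^ 3 - 4 * (q * (e₁ ^ 3 * e₅ * e₁₀ ^ 2 / e₂ ^ 2)) := by
    field_simp at hphi ⊢
    linear_combination -hphi
  rw [hsum, hdiff]
  exact ⟨hone, by linear_combination hthree + hone⟩

lemma psi_identities_of_relations (h₁ : e₁ ≠ 0) (h₂ : e₂ ≠ 0) (h₅ : e₅ ≠ 0) (h₁₀ : e₁₀ ≠ 0)
    (hfive : (5 : K) ≠ 0)
    (hpsi : e₂ ^ 4 / e₁ ^ 2 - q * (e₁₀ ^ 4 / e₅ ^ 2) = e₅ ^ 3 * e₂ / (e₁₀ * e₁))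
    (hphi : e₅ ^ 4 / e₁₀ ^ 2 - e₁ ^ 4 / e₂ ^ 2 = 4 * q * (e₁ * e₁₀ ^ 3 / (e₂ * e₅))) :
    4 * q * (e₂ ^ 2 / e₁) ^ 3 * (e₁₀ ^ 2 / e₅) =
        (e₁ ^ 5 / e₅ - e₂ ^ 5 / e₁₀) / 5 + 5 * (q * (e₅ ^ 5 / e₁) + q ^ 2 * (e₁₀ ^ 5 / e₂)) ∧
      4 * q ^ 2 * (e₂ ^ 2 / e₁) * (e₁₀ ^ 2 / e₅) ^ 3 =
        (e₁ ^ 5 / e₅ - e₂ ^ 5 / e₁₀) / 5 + (q * (e₅ ^ 5 / e₁) + q ^ 2 * (e₁₀ ^ 5 / e₂)) := by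
  have hdiff : (e₁ ^ 5 / e₅ - e₂ ^ 5 / e₁₀) / 5 = -(q * (e₁ ^ 2 * e₂ * e₁₀ ^ 3 / e₅ ^ 2)) := by
    linear_combination (norm := field_simp)
      -(e₁ ^ 2 * e₂ / e₁₀ * hpsi + e₁ * e₂ ^ 2 / e₅ * hphi) / 5
    ring
  have hsum : q * (e₅ ^ 5 / e₁) + q ^ 2 * (e₁₀ ^ 5 / e₂) =
      q * (e₂ ^ 3 * e₅ ^ 2 * e₁₀ / e₁ ^ 2) := by
    field_simp at hpsi ⊢
    linear_combination -q * hpsi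
  have hone : 4 * q ^ 2 * (e₂ ^ 2 / e₁) * (e₁₀ ^ 2 / e₅) ^ 3 =
      q * (e₂ ^ 3 * e₅ ^ 2 * e₁₀ / e₁ ^ 2) - q * (e₁ ^ 2 * e₂ * e₁₀ ^ 3 / e₅ ^ 2) := by
    field_simp at hphi ⊢
    linear_combination -q * hphi
  have hthree : 4 * q * (e₂ ^ 2 / e₁) ^ 3 * (e₁₀ ^ 2 / e₅) =
      4 * q ^ 2 * (e₂ ^ 2 / e₁) * (e₁₀ ^ 2 / e₅) ^ 3 +
        4 * (q * (e₂ ^ 3 * e₅ ^ 2 * e₁₀ / e₁ ^ 2)) := by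
    field_simp at hpsi ⊢
    linear_combination 4 * q * hpsi
  rw [hdiff, hsum]
  exact ⟨by linear_combination hthree + hone, by linear_combination hone⟩

end RationalIdentities

lemma theta_identities {q : ℂ} (hq : ‖q‖ < 1) :
    ramanujanPhi (-q) * ramanujanPhi (-q ^ 5) ^ 3 =
        (eulerE q ^ 5 / eulerE (q ^ 5) + 4 * (eulerE (q ^ 2) ^ 5 / eulerE (q ^ 10))) / 5
        - (q * (eulerE (q ^ 5) ^ 5 / eulerE q)
            - 4 * q ^ 2 * (eulerE (q ^ 10) ^ 5 / eulerE (q ^ 2))) ∧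
    ramanujanPhi (-q) ^ 3 * ramanujanPhi (-q ^ 5) =
        (eulerE q ^ 5 / eulerE (q ^ 5) + 4 * (eulerE (q ^ 2) ^ 5 / eulerE (q ^ 10))) / 5
        - 5 * (q * (eulerE (q ^ 5) ^ 5 / eulerE q)
            - 4 * q ^ 2 * (eulerE (q ^ 10) ^ 5 / eulerE (q ^ 2))) ∧
    4 * q * ramanujanPsi q ^ 3 * ramanujanPsi (q ^ 5) =
        (eulerE q ^ 5 / eulerE (q ^ 5) - eulerE (q ^ 2) ^ 5 / eulerE (q ^ 10)) / 5
        + 5 * (q * (eulerE (q ^ 5) ^ 5 / eulerE q)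
            + q ^ 2 * (eulerE (q ^ 10) ^ 5 / eulerE (q ^ 2))) ∧
    4 * q ^ 2 * ramanujanPsi q * ramanujanPsi (q ^ 5) ^ 3 =
        (eulerE q ^ 5 / eulerE (q ^ 5) - eulerE (q ^ 2) ^ 5 / eulerE (q ^ 10)) / 5
        + (q * (eulerE (q ^ 5) ^ 5 / eulerE q)
            + q ^ 2 * (eulerE (q ^ 10) ^ 5 / eulerE (q ^ 2))) := by
  have hE (k : ℕ) (hk : k ≠ 0) := eulerE_pow_ne_zero hq hk
  have hq5 := norm_pow_lt_one hq (m := 5) (by norm_num)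
  have hphi := phi_identities_of_relations (eulerE_ne_zero hq) (hE 2 two_ne_zero)
    (hE 5 (by norm_num)) (hE 10 (by norm_num)) (by norm_num) (eulerE_psi_relation hq)
    (eulerE_phi_relation hq)
  have hpsi := psi_identities_of_relations (eulerE_ne_zero hq) (hE 2 two_ne_zero)
    (hE 5 (by norm_num)) (hE 10 (by norm_num)) (by norm_num) (eulerE_psi_relation hq)
    (eulerE_phi_relation hq)
  rw [ramanujanPhi_neg hq, ramanujanPhi_neg hq5, ramanujanPsi_eq_prod hq,
    ramanujanPsi_eq_prod hq5, ← pow_mul]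
  exact ⟨hphi.1, hphi.2, hpsi.1, hpsi.2⟩

/-! ### Laurent series in `exp z` and logarithmic Hessians -/

/-- Convergence of the Laurent series `∑ cₙ exp (n z)` on the strip `Re z ∈ S`. -/
def LaurentSummable (c : ℤ → ℂ) (S : Set ℝ) : Prop :=
  ∀ z : ℂ, z.re ∈ S → Summable fun n : ℤ => c n * Complex.exp (n * z)

/-- The Laurent series `∑ cₙ xⁿ` in the logarithmic coordinate `x = exp z`. -/
noncomputable def laurentSum (c : ℤ → ℂ) (z : ℂ) : ℂ := ∑' n : ℤ, c n * Complex.exp (n * z)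

/-- The quantity `f'² - f f'' = -f² (log f)''`, which makes sense also at the zeros of `f`. -/
noncomputable def logHess (f : ℂ → ℂ) (z : ℂ) : ℂ := deriv f z ^ 2 - f z * deriv (deriv f) z

section Laurent

variable {c : ℤ → ℂ} {S : Set ℝ} {z : ℂ}

lemma norm_mul_exp_le_add {δ : ℝ} {w : ℂ} (h : |w.re - z.re| ≤ δ) (a : ℂ) (n : ℤ) :
    ‖a * Complex.exp (n * w)‖ ≤
      ‖a * Complex.exp (n * (z - δ))‖ + ‖a * Complex.exp (n * (z + δ))‖ := by
  have key : Real.exp (n * w.re) ≤ Real.exp (n * (z.re - δ)) + Real.exp (n * (z.re + δ)) := by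
    obtain ⟨h₁, h₂⟩ := abs_le.mp h
    rcases le_total 0 (n : ℝ) with hn | hn
    · exact (Real.exp_le_exp.mpr (by nlinarith)).trans
        (le_add_of_nonneg_left (Real.exp_pos _).le)
    · exact (Real.exp_le_exp.mpr (by nlinarith)).trans
        (le_add_of_nonneg_right (Real.exp_pos _).le)
  have hnorm (v : ℂ) : ‖a * Complex.exp (n * v)‖ = ‖a‖ * Real.exp (n * v.re) := by
    simp [Complex.norm_exp]
  rw [hnorm, hnorm, hnorm, ← mul_add, Complex.sub_re, Complex.add_re, Complex.ofReal_re]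
  exact mul_le_mul_of_nonneg_left key (norm_nonneg a)

lemma LaurentSummable.exists_summable_bound (hS : IsOpen S) (hc : LaurentSummable c S)
    (hz : z.re ∈ S) : ∃ U : Set ℂ, IsOpen U ∧ z ∈ U ∧ ∃ u : ℤ → ℝ, Summable u ∧
      ∀ (n : ℤ), ∀ w ∈ U, ‖c n * Complex.exp (n * w)‖ ≤ u n := by
  obtain ⟨ε, hε, hball⟩ := Metric.isOpen_iff.mp hS z.re hz
  have hmem : (z - (ε / 2 : ℝ)).re ∈ S ∧ (z + (ε / 2 : ℝ)).re ∈ S := by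
    constructor <;> refine hball ?_ <;> simp [abs_of_pos hε, hε]
  refine ⟨{w | |w.re - z.re| < ε / 2}, isOpen_lt (by fun_prop) continuous_const,
    by simpa using hε, _, (hc _ hmem.1).norm.add (hc _ hmem.2).norm,
    fun n w hw => norm_mul_exp_le_add (le_of_lt hw) (c n) n⟩

lemma deriv_mul_cexp (a : ℂ) (n : ℤ) (z : ℂ) :
    deriv (fun w => a * Complex.exp (n * w)) z = n * a * Complex.exp (n * z) := by
  have := (((hasDerivAt_id z).const_mul (n : ℂ)).cexp).const_mul a
  exact this.deriv.trans (by simp only [id]; ring)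

lemma LaurentSummable.intCast_mul (hS : IsOpen S) (hc : LaurentSummable c S) :
    LaurentSummable (fun n => n * c n) S := by
  intro z hz
  obtain ⟨U, hU, hzU, u, hu, hle⟩ := hc.exists_summable_bound hS hz
  simpa only [deriv_mul_cexp] using (Complex.hasSum_deriv_of_summable_norm hu
    (fun n => by fun_prop) hU hle hzU).summable

lemma LaurentSummable.hasDerivAt (hS : IsOpen S) (hc : LaurentSummable c S) (hz : z.re ∈ S) :
    HasDerivAt (laurentSum c) (laurentSum (fun n => n * c n) z) z := by
  obtain ⟨U, hU, hzU, u, hu, hle⟩ := hc.exists_summable_bound hS hz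
  have hdiff : DifferentiableAt ℂ (laurentSum c) z :=
    (Complex.differentiableOn_tsum_of_summable_norm hu (fun n => by fun_prop) hU
      hle).differentiableAt (hU.mem_nhds hzU)
  have hsum := Complex.hasSum_deriv_of_summable_norm hu (fun n => by fun_prop) hU hle hzU
  simp only [deriv_mul_cexp] at hsum
  exact hdiff.hasDerivAt.congr_deriv hsum.tsum_eq.symm

lemma LaurentSummable.analyticAt (hS : IsOpen S) (hc : LaurentSummable c S) (hz : z.re ∈ S) :
    AnalyticAt ℂ (laurentSum c) z :=
  DifferentiableOn.analyticAt (s := Complex.re ⁻¹' S)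
    (fun _ hw => (hc.hasDerivAt hS hw).differentiableAt.differentiableWithinAt)
    ((hS.preimage Complex.continuous_re).mem_nhds hz)

lemma LaurentSummable.deriv_deriv (hS : IsOpen S) (hc : LaurentSummable c S) (hz : z.re ∈ S) :
    deriv (deriv (laurentSum c)) z = laurentSum (fun n => n * (n * c n)) z := by
  have hev : deriv (laurentSum c) =ᶠ[𝓝 z] laurentSum fun n => n * c n := by
    filter_upwards [(hS.preimage Complex.continuous_re).mem_nhds hz] with w hw
    exact (hc.hasDerivAt hS hw).deriv
  rw [hev.deriv_eq, ((hc.intCast_mul hS).hasDerivAt hS hz).deriv]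

lemma logHess_congr {f g : ℂ → ℂ} (h : f =ᶠ[𝓝 z] g) : logHess f z = logHess g z := by
  rw [logHess, logHess, h.deriv_eq, h.deriv.deriv_eq, h.eq_of_nhds]

lemma logHess_mul {f g : ℂ → ℂ} (hf : AnalyticAt ℂ f z) (hg : AnalyticAt ℂ g z) :
    logHess (fun w => f w * g w) z = g z ^ 2 * logHess f z + f z ^ 2 * logHess g z := by
  have hderiv : deriv (fun w => f w * g w) =ᶠ[𝓝 z] fun w => deriv f w * g w + f w * deriv g w := by
    filter_upwards [hf.eventually_analyticAt, hg.eventually_analyticAt] with w hfw hgw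
    exact deriv_fun_mul hfw.differentiableAt hgw.differentiableAt
  have hf' := hf.differentiableAt.hasDerivAt
  have hg' := hg.differentiableAt.hasDerivAt
  have hderiv₂ := (hf.deriv.differentiableAt.hasDerivAt.fun_mul hg').fun_add
    (hf'.fun_mul hg.deriv.differentiableAt.hasDerivAt)
  rw [logHess, hderiv.deriv_eq, hderiv.eq_of_nhds, hderiv₂.deriv, logHess, logHess]
  ring

lemma logHess_const_mul_exp {f : ℂ → ℂ} (hf : AnalyticAt ℂ f z) (a : ℂ) :
    logHess (fun w => a * Complex.exp (f w)) z =
      -(a * Complex.exp (f z)) ^ 2 * deriv (deriv f) z := by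
  have hderiv : deriv (fun w => a * Complex.exp (f w)) =ᶠ[𝓝 z]
      fun w => a * Complex.exp (f w) * deriv f w := by
    filter_upwards [hf.eventually_analyticAt] with w hw
    rw [(hw.differentiableAt.hasDerivAt.cexp.const_mul a).deriv, mul_assoc]
  have hderiv₂ := (hf.differentiableAt.hasDerivAt.cexp.const_mul a).fun_mul
    hf.deriv.differentiableAt.hasDerivAt
  rw [logHess, hderiv.deriv_eq, hderiv.eq_of_nhds, hderiv₂.deriv]
  ring

lemma logHess_one_sub_exp (z : ℂ) : logHess (fun w => 1 - Complex.exp w) z = Complex.exp z := by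
  have hderiv : deriv (fun w => 1 - Complex.exp w) = fun w => -Complex.exp w :=
    funext fun w => ((Complex.hasDerivAt_exp w).const_sub 1).deriv
  have hderiv₂ : deriv (fun w => -Complex.exp w) z = -Complex.exp z :=
    (Complex.hasDerivAt_exp z).neg.deriv
  rw [logHess, hderiv, hderiv₂]
  ring

end Laurent

/-! ### The logarithm of the triple product -/

/-- The coefficients of the Laurent series of `-log ((q x; q)_∞ (q / x; q)_∞)`. The value at
`k = 0` is `0`, by division by zero. -/
noncomputable def logCoeff (q : ℂ) (k : ℤ) : ℂ :=
  q ^ k.natAbs / (k.natAbs * (1 - q ^ k.natAbs))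

/-- The annulus `|q| < |x| < |q|⁻¹`, in the coordinate `log |x|`. -/
def logAnnulus (q : ℂ) : Set ℝ :=
  {σ | ‖q‖ * Real.exp σ < 1 ∧ ‖q‖ * Real.exp (-σ) < 1}

section Logarithm

variable {a q z : ℂ}

lemma one_sub_pow_ne_zero (hq : ‖q‖ < 1) {k : ℕ} (hk : k ≠ 0) : 1 - q ^ k ≠ 0 := by
  intro h
  simpa [← sub_eq_zero.mp h] using norm_pow_lt_one hq hk

lemma norm_mul_pow_lt_one (hq : ‖q‖ < 1) (ha : ‖a‖ < 1) (n : ℕ) : ‖a * q ^ n‖ < 1 := by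
  rw [norm_mul, norm_pow]
  exact mul_lt_one_of_nonneg_of_lt_one_left (norm_nonneg _) ha (pow_le_one₀ (norm_nonneg _) hq.le)

lemma summable_mul_pow_pow_div (hq : ‖q‖ < 1) (ha : ‖a‖ < 1) :
    Summable fun p : ℕ × ℕ => (a * q ^ p.1) ^ p.2 / p.2 := by
  refine Summable.of_norm_bounded (g := fun p : ℕ × ℕ => ‖q‖ ^ p.1 * ‖a‖ ^ p.2)
    ((summable_geometric_of_lt_one (norm_nonneg _) hq).mul_of_nonneg
      (summable_geometric_of_lt_one (norm_nonneg _) ha) (fun _ => by positivity)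
      (fun _ => by positivity)) ?_
  rintro ⟨n, k⟩
  rcases Nat.eq_zero_or_pos k with rfl | hk
  · simp
  · simp only [norm_div, norm_pow, norm_mul, Complex.norm_natCast]
    calc (‖a‖ * ‖q‖ ^ n) ^ k / k
        ≤ (‖a‖ * ‖q‖ ^ n) ^ k := div_le_self (by positivity) (by exact_mod_cast hk)
      _ = (‖q‖ ^ n) ^ k * ‖a‖ ^ k := by ring
      _ ≤ ‖q‖ ^ n * ‖a‖ ^ k := by
        gcongr
        exact pow_le_of_le_one (by positivity) (pow_le_one₀ (norm_nonneg _) hq.le) hk.ne'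

lemma hasSum_neg_log_qPochhammerInf (hq : ‖q‖ < 1) (ha : ‖a‖ < 1) :
    HasSum (fun k : ℕ => a ^ k / (k * (1 - q ^ k))) (-∑' n : ℕ, Complex.log (1 - a * q ^ n)) := by
  have hF := (summable_mul_pow_pow_div hq ha).hasSum
  have hrow (n : ℕ) : HasSum (fun k : ℕ => (a * q ^ n) ^ k / k) (-Complex.log (1 - a * q ^ n)) :=
    Complex.hasSum_taylorSeries_neg_log (norm_mul_pow_lt_one hq ha n)
  have hcol (k : ℕ) : HasSum (fun n : ℕ => (a * q ^ n) ^ k / k) (a ^ k / (k * (1 - q ^ k))) := by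
    rcases eq_or_ne k 0 with rfl | hk
    · simp
    · have := (hasSum_geometric_of_norm_lt_one (norm_pow_lt_one hq hk)).mul_left (a ^ k / k)
      rw [← div_eq_mul_inv, div_div] at this
      refine this.congr_fun fun n => ?_
      rw [mul_pow, ← pow_mul, ← pow_mul, mul_comm n k]
      ring
  rw [← tsum_neg, (hF.prod_fiberwise hrow).tsum_eq]
  exact ((Equiv.prodComm ℕ ℕ).hasSum_iff.mpr hF).prod_fiberwise hcol

lemma exp_tsum_log_eq_qPochhammerInf (hq : ‖q‖ < 1) (ha : ‖a‖ < 1) :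
    Complex.exp (∑' n : ℕ, Complex.log (1 - a * q ^ n)) = qPochhammerInf a q := by
  refine Complex.cexp_tsum_eq_tprod (fun n h => ?_) ?_
  · simpa [← sub_eq_zero.mp h] using norm_mul_pow_lt_one hq ha n
  · simpa only [sub_eq_add_neg] using
      Complex.summable_log_one_add_of_summable (summable_norm_mul_pow a hq).of_norm

lemma isOpen_logAnnulus (q : ℂ) : IsOpen (logAnnulus q) := by
  refine IsOpen.and (isOpen_lt ?_ continuous_const) (isOpen_lt ?_ continuous_const) <;> fun_prop

lemma norm_lt_one_of_mem_logAnnulus (hz : z.re ∈ logAnnulus q) :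
    ‖Complex.exp z * q‖ < 1 ∧ ‖q / Complex.exp z‖ < 1 := by
  rw [mul_comm, div_eq_mul_inv, ← Complex.exp_neg, norm_mul, norm_mul, Complex.norm_exp,
    Complex.norm_exp]
  exact hz

lemma hasSum_logCoeff (hq : ‖q‖ < 1) (hz : z.re ∈ logAnnulus q) :
    HasSum (fun n : ℤ => logCoeff q n * Complex.exp (n * z))
      (-(∑' n : ℕ, Complex.log (1 - Complex.exp z * q * q ^ n) +
        ∑' n : ℕ, Complex.log (1 - q / Complex.exp z * q ^ n))) := by
  obtain ⟨h₁, h₂⟩ := norm_lt_one_of_mem_logAnnulus hz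
  have hpos : HasSum (fun n : ℕ => logCoeff q n * Complex.exp ((n : ℤ) * z)) _ :=
    (hasSum_neg_log_qPochhammerInf hq h₁).congr_fun fun n => by
      rw [logCoeff, mul_pow, ← Complex.exp_nat_mul]
      simp only [Int.natAbs_natCast, Int.cast_natCast]
      ring
  have hneg : HasSum (fun n : ℕ => logCoeff q (-n) * Complex.exp ((-n : ℤ) * z)) _ :=
    (hasSum_neg_log_qPochhammerInf hq h₂).congr_fun fun n => by
      rw [logCoeff, div_eq_mul_inv q, ← Complex.exp_neg, mul_pow, ← Complex.exp_nat_mul]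
      simp only [Int.natAbs_neg, Int.natAbs_natCast, Int.cast_neg, Int.cast_natCast, mul_neg,
        neg_mul]
      ring
  have := hpos.of_nat_of_neg (f := fun n : ℤ => logCoeff q n * Complex.exp (n * z)) hneg
  have h₀ : logCoeff q 0 = 0 := by simp [logCoeff]
  rwa [h₀, zero_mul, sub_zero, ← neg_add] at this

lemma laurentSummable_logCoeff (hq : ‖q‖ < 1) : LaurentSummable (logCoeff q) (logAnnulus q) :=
  fun _ hz => (hasSum_logCoeff hq hz).summable

lemma qPochhammerInf_mul_eq_exp (hq : ‖q‖ < 1) (hz : z.re ∈ logAnnulus q) :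
    qPochhammerInf (Complex.exp z * q) q * qPochhammerInf (q / Complex.exp z) q =
      Complex.exp (-laurentSum (logCoeff q) z) := by
  obtain ⟨h₁, h₂⟩ := norm_lt_one_of_mem_logAnnulus hz
  rw [laurentSum, (hasSum_logCoeff hq hz).tsum_eq, neg_neg, Complex.exp_add,
    exp_tsum_log_eq_qPochhammerInf hq h₁, exp_tsum_log_eq_qPochhammerInf hq h₂]

end Logarithm

/-! ### The addition formula for `theta` and its logarithmic Hessian -/

/-- The splitting of `ℤ × ℤ` by the parity of the sum of the coordinates:
`(j, r, s)` is sent to `(r + s + j, r - s)`. -/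
def parityEquiv : Fin 2 × (ℤ × ℤ) ≃ ℤ × ℤ where
  toFun p := (p.2.1 + p.2.2 + (p.1 : ℕ), p.2.1 - p.2.2)
  invFun v := (⟨((v.1 + v.2) % 2).toNat, by omega⟩, ((v.1 + v.2) / 2, (v.1 + v.2) / 2 - v.2))
  left_inv := by
    rintro ⟨⟨j, hj⟩, m, n⟩
    simp only [Prod.mk.injEq, Fin.mk.injEq]
    refine ⟨?_, ?_, ?_⟩ <;> omega
  right_inv := by
    rintro ⟨x, y⟩
    simp only [Prod.mk.injEq]
    constructor <;> omega

/-- The series `∑ q^{r² - r} x^{2r}` in the even powers of `x`, one of the two functions spanning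
the products `theta (x y) q * theta (x / y) q`, as functions of `x`. -/
noncomputable def thetaEven (q x : ℂ) : ℂ := ∑' r : ℤ, q ^ (r ^ 2 - r) * x ^ (2 * r)

/-- The series `∑ q^{r²} x^{2r + 1}` in the odd powers of `x`, the companion of `thetaEven`. -/
noncomputable def thetaOdd (q x : ℂ) : ℂ := ∑' r : ℤ, q ^ (r ^ 2) * x ^ (2 * r + 1)

/-- The image of the theta function under the `k`-th power of `x d/dx`. -/
noncomputable def thetaMoment (q : ℂ) (k : ℕ) (x : ℂ) : ℂ :=
  ∑' n : ℤ, (n : ℂ) ^ k * (thetaCoeff q n * x ^ n)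

/-- The function `(D θ)² - θ D² θ`, where `D = x d/dx`. -/
noncomputable def thetaHess (q x : ℂ) : ℂ :=
  thetaMoment q 1 x ^ 2 - thetaMoment q 0 x * thetaMoment q 2 x

section Addition

variable {q x y : ℂ}

lemma tsum_prod_mul {u w : ℤ → ℂ} (h : Summable fun v : ℤ × ℤ => u v.1 * w v.2) :
    ∑' v : ℤ × ℤ, u v.1 * w v.2 = (∑' r, u r) * ∑' s, w s := by
  rw [h.tsum_prod]
  simp only [tsum_mul_left, tsum_mul_right]

lemma tsum_parity {F : ℤ × ℤ → ℂ} (hF : Summable F) {f g f' g' : ℤ → ℂ}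
    (h : ∀ r s, F (r + s, r - s) = f r * g s)
    (h' : ∀ r s, F (r + s + 1, r - s) = -(f' r * g' s)) :
    ∑' v, F v = (∑' r, f r) * (∑' s, g s) - (∑' r, f' r) * ∑' s, g' s := by
  have hs := parityEquiv.summable_iff.mpr hF
  have heven (v : ℤ × ℤ) : (F ∘ parityEquiv) (0, v) = f v.1 * g v.2 := by simp [parityEquiv, h]
  have hodd (v : ℤ × ℤ) : (F ∘ parityEquiv) (1, v) = -(f' v.1 * g' v.2) := by
    simp [parityEquiv, h']
  have hs₀ := (hs.comp_injective (Prod.mk_right_injective (0 : Fin 2))).congr heven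
  have hs₁ := ((hs.comp_injective (Prod.mk_right_injective (1 : Fin 2))).neg).congr
    (g := fun v : ℤ × ℤ => f' v.1 * g' v.2) fun v => by
      rw [← neg_neg (_ * _), ← hodd]
      rfl
  calc ∑' v, F v = ∑' v, (F ∘ parityEquiv) v := (parityEquiv.tsum_eq F).symm
    _ = ∑ j : Fin 2, ∑' v, (F ∘ parityEquiv) (j, v) := by rw [hs.tsum_prod, tsum_fintype]
    _ = _ := by
      rw [Fin.sum_univ_two, tsum_congr heven, tsum_congr hodd, tsum_neg, tsum_prod_mul hs₀,
        tsum_prod_mul hs₁, sub_eq_add_neg]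

lemma thetaCoeff_mul_even (hq₀ : q ≠ 0) (r s : ℤ) :
    thetaCoeff q (r + s) * thetaCoeff q (r - s) = q ^ (r ^ 2 - r) * q ^ (s ^ 2) := by
  have htri : tri (r + s) + tri (r - s) = r ^ 2 - r + s ^ 2 := by
    linarith [two_mul_tri (r + s), two_mul_tri (r - s)]
  rw [thetaCoeff, thetaCoeff, mul_mul_mul_comm, ← zpow_add₀ hq₀, htri, ← zpow_add₀ hq₀,
    ← zpow_add₀ (by norm_num : (-1 : ℂ) ≠ 0), Even.neg_one_zpow ⟨r, by ring⟩, one_mul]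

lemma thetaCoeff_mul_odd (hq₀ : q ≠ 0) (r s : ℤ) :
    thetaCoeff q (r + s + 1) * thetaCoeff q (r - s) = -(q ^ (r ^ 2) * q ^ (s ^ 2 + s)) := by
  have htri : tri (r + s + 1) + tri (r - s) = r ^ 2 + (s ^ 2 + s) := by
    linarith [two_mul_tri (r + s + 1), two_mul_tri (r - s)]
  rw [thetaCoeff, thetaCoeff, mul_mul_mul_comm, ← zpow_add₀ hq₀, htri, ← zpow_add₀ hq₀,
    ← zpow_add₀ (by norm_num : (-1 : ℂ) ≠ 0), Odd.neg_one_zpow ⟨r, by ring⟩, neg_one_mul]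

lemma thetaOdd_eq_mul_tsum (q : ℂ) (hy : y ≠ 0) :
    thetaOdd q y = y * ∑' s : ℤ, q ^ (s ^ 2) * y ^ (2 * s) := by
  rw [thetaOdd, ← tsum_mul_left]
  refine tsum_congr fun s => ?_
  rw [zpow_add_one₀ hy]
  ring

lemma thetaEven_eq_mul_tsum (q : ℂ) (hy : y ≠ 0) :
    thetaEven q y = y * ∑' s : ℤ, q ^ (s ^ 2 + s) * y ^ (2 * s + 1) := by
  rw [thetaEven, ← (Equiv.addRight (1 : ℤ)).tsum_eq fun r => q ^ (r ^ 2 - r) * y ^ (2 * r),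
    ← tsum_mul_left]
  refine tsum_congr fun s => ?_
  rw [Equiv.coe_addRight, show (s + 1) ^ 2 - (s + 1) = s ^ 2 + s by ring,
    show 2 * (s + 1) = 2 * s + 1 + 1 by ring, zpow_add_one₀ hy (2 * s + 1)]
  ring

lemma mul_theta_mul_theta (hq₀ : q ≠ 0) (hq : ‖q‖ < 1) (hx : x ≠ 0) (hy : y ≠ 0) :
    y * (theta (x * y) q * theta (x / y) q) =
      thetaEven q x * thetaOdd q y - thetaOdd q x * thetaEven q y := by
  have s₁ := summable_norm_theta hq₀ hq (mul_ne_zero hx hy)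
  have s₂ := summable_norm_theta hq₀ hq (div_ne_zero hx hy)
  have hpow (m n : ℤ) : (x * y) ^ m * (x / y) ^ n = x ^ (m + n) * y ^ (m - n) := by
    rw [mul_zpow, div_zpow, zpow_add₀ hx, zpow_sub₀ hy]
    ring
  have key := tsum_parity (summable_mul_of_summable_norm s₁ s₂)
    (f := fun r => q ^ (r ^ 2 - r) * x ^ (2 * r)) (g := fun s => q ^ (s ^ 2) * y ^ (2 * s))
    (f' := fun r => q ^ (r ^ 2) * x ^ (2 * r + 1))
    (g' := fun s => q ^ (s ^ 2 + s) * y ^ (2 * s + 1))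
    (fun r s => by
      rw [mul_mul_mul_comm, thetaCoeff_mul_even hq₀, hpow, show r + s + (r - s) = 2 * r by ring,
        show r + s - (r - s) = 2 * s by ring, mul_mul_mul_comm])
    (fun r s => by
      rw [mul_mul_mul_comm, thetaCoeff_mul_odd hq₀, hpow,
        show r + s + 1 + (r - s) = 2 * r + 1 by ring,
        show r + s + 1 - (r - s) = 2 * s + 1 by ring, neg_mul, mul_mul_mul_comm])
  rw [theta, theta, tsum_mul_tsum_of_summable_norm s₁ s₂, key, thetaOdd_eq_mul_tsum q hy,
    thetaEven_eq_mul_tsum q hy, thetaEven, thetaOdd]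
  ring

lemma theta_sq (hq₀ : q ≠ 0) (hq : ‖q‖ < 1) (hx : x ≠ 0) :
    theta x q ^ 2 = thetaEven q x * thetaOdd q 1 - thetaOdd q x * thetaEven q 1 := by
  simpa only [mul_one, div_one, one_mul, ← sq] using mul_theta_mul_theta hq₀ hq hx one_ne_zero

lemma thetaMoment_exp (q : ℂ) (k : ℕ) (z : ℂ) :
    thetaMoment q k (Complex.exp z) = laurentSum (fun n => n ^ k * thetaCoeff q n) z := by
  refine tsum_congr fun n => ?_
  rw [← Complex.exp_int_mul, mul_assoc]

lemma laurentSummable_thetaCoeff (hq₀ : q ≠ 0) (hq : ‖q‖ < 1) (k : ℕ) :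
    LaurentSummable (fun n => n ^ k * thetaCoeff q n) Set.univ := by
  induction k with
  | zero =>
    intro z _
    simpa only [pow_zero, one_mul, Complex.exp_int_mul] using
      (summable_norm_theta hq₀ hq (Complex.exp_ne_zero z)).of_norm
  | succ k ih => simpa only [pow_succ', mul_assoc] using ih.intCast_mul isOpen_univ

lemma summable_norm_thetaMoment (hq₀ : q ≠ 0) (hq : ‖q‖ < 1) (hx : x ≠ 0) (k : ℕ) :
    Summable fun n : ℤ => ‖(n : ℂ) ^ k * (thetaCoeff q n * x ^ n)‖ := by
  have := (laurentSummable_thetaCoeff hq₀ hq k (Complex.log x) (Set.mem_univ _)).norm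
  simpa only [Complex.exp_int_mul, Complex.exp_log hx, mul_assoc] using this

lemma hasDerivAt_thetaMoment (hq₀ : q ≠ 0) (hq : ‖q‖ < 1) (k : ℕ) (z : ℂ) :
    HasDerivAt (fun w => thetaMoment q k (Complex.exp w))
      (thetaMoment q (k + 1) (Complex.exp z)) z := by
  have := (laurentSummable_thetaCoeff hq₀ hq k).hasDerivAt isOpen_univ (Set.mem_univ z.re)
  simp only [thetaMoment_exp]
  simpa only [pow_succ', mul_assoc] using this

lemma thetaMoment_zero (q x : ℂ) : thetaMoment q 0 x = theta x q := by
  simp [thetaMoment, theta]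

lemma thetaHess_exp (hq₀ : q ≠ 0) (hq : ‖q‖ < 1) (z : ℂ) :
    thetaHess q (Complex.exp z) = logHess (fun w => theta (Complex.exp w) q) z := by
  have hderiv (k : ℕ) : deriv (fun w => thetaMoment q k (Complex.exp w)) =
      fun w => thetaMoment q (k + 1) (Complex.exp w) :=
    funext fun w => (hasDerivAt_thetaMoment hq₀ hq k w).deriv
  simp only [thetaHess, logHess, ← thetaMoment_zero, hderiv]

lemma exists_thetaHess_eq (hq₀ : q ≠ 0) (hq : ‖q‖ < 1) :
    ∃ α β : ℂ, ∀ x : ℂ, x ≠ 0 → thetaHess q x = α * thetaEven q x + β * thetaOdd q x := by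
  refine ⟨-(∑' s : ℤ, q ^ (s ^ 2) * (2 * s) ^ 2) / 2,
    (∑' s : ℤ, q ^ (s ^ 2 + s) * (2 * s + 1) ^ 2) / 2, fun x hx => ?_⟩
  have hs := summable_norm_thetaMoment hq₀ hq hx
  -- `2 θ D²θ - 2 (Dθ)²` is the double series with weights `m² + n² - 2 m n = (m - n)²`.
  have hF := ((summable_mul_of_summable_norm (hs 2) (hs 0)).hasSum.add
    (summable_mul_of_summable_norm (hs 0) (hs 2)).hasSum).sub
    ((summable_mul_of_summable_norm (hs 1) (hs 1)).hasSum.mul_left 2)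
  simp only [← tsum_mul_tsum_of_summable_norm (hs _) (hs _)] at hF
  have hpow (m n : ℤ) : x ^ m * x ^ n = x ^ (m + n) := (zpow_add₀ hx m n).symm
  have key := tsum_parity hF.summable
    (f := fun r => q ^ (r ^ 2 - r) * x ^ (2 * r)) (g := fun s => q ^ (s ^ 2) * (2 * s) ^ 2)
    (f' := fun r => q ^ (r ^ 2) * x ^ (2 * r + 1))
    (g' := fun s => q ^ (s ^ 2 + s) * (2 * s + 1) ^ 2)
    (fun r s => by
      have hx' := hpow (r + s) (r - s)
      rw [show r + s + (r - s) = 2 * r by ring] at hx'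
      rw [← hx']
      push_cast
      linear_combination (2 * s) ^ 2 * (x ^ (r + s) * x ^ (r - s)) * thetaCoeff_mul_even hq₀ r s)
    (fun r s => by
      have hx' := hpow (r + s + 1) (r - s)
      rw [show r + s + 1 + (r - s) = 2 * r + 1 by ring] at hx'
      rw [← hx']
      push_cast
      linear_combination
        (2 * s + 1) ^ 2 * (x ^ (r + s + 1) * x ^ (r - s)) * thetaCoeff_mul_odd hq₀ r s)
  rw [hF.tsum_eq] at key
  simp only [thetaHess, thetaMoment, thetaEven, thetaOdd]
  linear_combination (-1 / 2) * key

lemma exists_thetaHess_mul_sub (hq₀ : q ≠ 0) (hq : ‖q‖ < 1) :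
    ∃ K : ℂ, ∀ x y : ℂ, x ≠ 0 → y ≠ 0 →
      thetaHess q x * theta y q ^ 2 - thetaHess q y * theta x q ^ 2 =
        K * (y * (theta (x * y) q * theta (x / y) q)) := by
  obtain ⟨α, β, h⟩ := exists_thetaHess_eq hq₀ hq
  refine ⟨-(α * thetaEven q 1 + β * thetaOdd q 1), fun x y hx hy => ?_⟩
  rw [mul_theta_mul_theta hq₀ hq hx hy, theta_sq hq₀ hq hx, theta_sq hq₀ hq hy, h x hx, h y hy]
  ring

end Addition

/-! ### The Weierstrass function attached to `theta` -/

/-- The theta function without its factor `1 - x`, that is, the product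
`(q; q)_∞ (q x; q)_∞ (q / x; q)_∞`. -/
noncomputable def thetaReg (q x : ℂ) : ℂ :=
  eulerE q * (qPochhammerInf (x * q) q * qPochhammerInf (q / x) q)

/-- The Lambert series `∑_{k ∈ ℤ} |k| q^{|k|} / (1 - q^{|k|}) x^k`. -/
noncomputable def lambertSum (q x : ℂ) : ℂ :=
  ∑' k : ℤ, k.natAbs * q ^ k.natAbs / (1 - q ^ k.natAbs) * x ^ k

/-- The annulus `‖q‖ < ‖x‖ < ‖q‖⁻¹` of convergence of `lambertSum`. -/
def annulus (q : ℂ) : Set ℂ := {x | ‖q‖ < ‖x‖ ∧ ‖q‖ * ‖x‖ < 1}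

section Weierstrass

variable {q x y z : ℂ}

lemma norm_pos_of_mem_annulus (hx : x ∈ annulus q) : 0 < ‖x‖ := (norm_nonneg q).trans_lt hx.1

lemma ne_zero_of_mem_annulus (hx : x ∈ annulus q) : x ≠ 0 :=
  norm_pos_iff.mp (norm_pos_of_mem_annulus hx)

lemma mem_annulus_of_norm_eq_one (hq : ‖q‖ < 1) (hx : ‖x‖ = 1) : x ∈ annulus q := by
  simp [annulus, hx, hq]

lemma exists_exp_eq_of_mem_annulus (hx : x ∈ annulus q) :
    ∃ z : ℂ, z.re ∈ logAnnulus q ∧ Complex.exp z = x := by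
  have hpos := norm_pos_of_mem_annulus hx
  refine ⟨Complex.log x, ⟨?_, ?_⟩, Complex.exp_log (ne_zero_of_mem_annulus hx)⟩
  · rw [Complex.log_re, Real.exp_log hpos]
    exact hx.2
  · rw [Complex.log_re, Real.exp_neg, Real.exp_log hpos, ← div_eq_mul_inv, div_lt_one hpos]
    exact hx.1

lemma theta_eq_thetaReg (hq₀ : q ≠ 0) (hq : ‖q‖ < 1) (hx : x ≠ 0) :
    theta x q = (1 - x) * thetaReg q x := by
  rw [theta_eq_prod hq₀ hq hx, qPochhammerInf_eq_one_sub_mul x hq, thetaReg]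
  ring

lemma theta_exp_eventuallyEq (hq₀ : q ≠ 0) (hq : ‖q‖ < 1) (hz : z.re ∈ logAnnulus q) :
    (fun w => theta (Complex.exp w) q) =ᶠ[𝓝 z] fun w =>
      (1 - Complex.exp w) * (eulerE q * Complex.exp (-laurentSum (logCoeff q) w)) := by
  filter_upwards [((isOpen_logAnnulus q).preimage Complex.continuous_re).mem_nhds hz] with w hw
  rw [theta_eq_thetaReg hq₀ hq (Complex.exp_ne_zero w), thetaReg, qPochhammerInf_mul_eq_exp hq hw]

lemma natAbs_mul_pow_div (hq : ‖q‖ < 1) (k : ℤ) :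
    (k.natAbs : ℂ) * q ^ k.natAbs / (1 - q ^ k.natAbs) = k * (k * logCoeff q k) := by
  rcases eq_or_ne k 0 with rfl | hk
  · simp
  · have hk' : (k.natAbs : ℂ) ≠ 0 := Nat.cast_ne_zero.mpr (Int.natAbs_ne_zero.mpr hk)
    have hsq : (k : ℂ) * k = k.natAbs * k.natAbs := by
      rw [← Int.cast_mul, ← Int.natAbs_mul_self' k, Int.cast_mul, Int.cast_natCast]
    have := one_sub_pow_ne_zero hq (Int.natAbs_ne_zero.mpr hk)
    rw [← mul_assoc, hsq, logCoeff]
    field_simp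

lemma lambertSum_exp (hq : ‖q‖ < 1) (z : ℂ) :
    lambertSum q (Complex.exp z) = laurentSum (fun n => n * (n * logCoeff q n)) z :=
  tsum_congr fun k => by rw [natAbs_mul_pow_div hq, Complex.exp_int_mul]

lemma thetaHess_eq (hq₀ : q ≠ 0) (hq : ‖q‖ < 1) (hx : x ∈ annulus q) :
    thetaHess q x = thetaReg q x ^ 2 * (x + (1 - x) ^ 2 * lambertSum q x) := by
  obtain ⟨z, hz, rfl⟩ := exists_exp_eq_of_mem_annulus hx
  have hS := laurentSummable_logCoeff hq
  have hanalytic := hS.analyticAt (isOpen_logAnnulus q) hz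
  have hneg : deriv (deriv fun w => -laurentSum (logCoeff q) w) z =
      -lambertSum q (Complex.exp z) := by
    rw [deriv.fun_neg', deriv.fun_neg, hS.deriv_deriv (isOpen_logAnnulus q) hz, lambertSum_exp hq]
  rw [thetaHess_exp hq₀ hq, logHess_congr (theta_exp_eventuallyEq hq₀ hq hz),
    logHess_mul (by fun_prop) (by fun_prop), logHess_one_sub_exp,
    logHess_const_mul_exp hanalytic.fun_neg, hneg, thetaReg, qPochhammerInf_mul_eq_exp hq hz]
  ring

lemma theta_one (hq₀ : q ≠ 0) (hq : ‖q‖ < 1) : theta 1 q = 0 := by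
  rw [theta_eq_thetaReg hq₀ hq one_ne_zero, sub_self, zero_mul]

lemma theta_neg_one_ne_zero (hq₀ : q ≠ 0) (hq : ‖q‖ < 1) : theta (-1) q ≠ 0 := by
  have hne := qPochhammerInf_ne_zero_of_norm_lt_one hq (a := -q) (by rwa [norm_neg])
  rw [theta_eq_thetaReg hq₀ hq (by norm_num), thetaReg, neg_one_mul, div_neg, div_one]
  exact mul_ne_zero (by norm_num) (mul_ne_zero (eulerE_ne_zero hq) (mul_ne_zero hne hne))

lemma thetaHess_one (hq₀ : q ≠ 0) (hq : ‖q‖ < 1) : thetaHess q 1 = eulerE q ^ 6 := by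
  rw [thetaHess_eq hq₀ hq (mem_annulus_of_norm_eq_one hq norm_one), thetaReg, one_mul, div_one,
    ← eulerE]
  ring

lemma thetaHess_mul_sub (hq₀ : q ≠ 0) (hq : ‖q‖ < 1) (hx : x ≠ 0) (hy : y ≠ 0) :
    thetaHess q x * theta y q ^ 2 - thetaHess q y * theta x q ^ 2 =
      -eulerE q ^ 6 * (y * (theta (x * y) q * theta (x / y) q)) := by
  obtain ⟨K, hK⟩ := exists_thetaHess_mul_sub hq₀ hq
  -- Since `theta 1 q = 0`, the point `(-1, 1)` determines the constant.
  have h := hK (-1) 1 (by norm_num) one_ne_zero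
  rw [theta_one hq₀ hq, mul_one, div_one, thetaHess_one hq₀ hq] at h
  have hK' : K = -eulerE q ^ 6 :=
    mul_right_cancel₀ (pow_ne_zero 2 (theta_neg_one_ne_zero hq₀ hq)) (by linear_combination -h)
  rw [hK x y hx hy, hK']

end Weierstrass

section Weierstrass

variable {q x y : ℂ}

lemma pow_mem_annulus (hq₀ : q ≠ 0) (hq : ‖q‖ < 1) {m n : ℕ} (h : m < n) :
    q ^ m ∈ annulus (q ^ n) := by
  have hpos := norm_pos_iff.mpr hq₀
  simp only [annulus, Set.mem_ofPred_eq, norm_pow]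
  refine ⟨pow_lt_pow_right_of_lt_one₀ hpos hq h, ?_⟩
  rw [← pow_add]
  exact pow_lt_one₀ hpos.le hq (by omega)

lemma theta_div_self (hq₀ : q ≠ 0) (hq : ‖q‖ < 1) (hx : x ≠ 0) :
    theta (q / x) q = theta x q := by
  rw [theta_eq_prod hq₀ hq hx, theta_eq_prod hq₀ hq (div_ne_zero hq₀ hx), div_div_cancel₀ hq₀,
    mul_comm (qPochhammerInf x q)]

lemma theta_inv (hq₀ : q ≠ 0) (hq : ‖q‖ < 1) (hx : x ≠ 0) :
    theta x⁻¹ q = -x⁻¹ * theta x q := by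
  rw [theta_eq_thetaReg hq₀ hq hx, theta_eq_thetaReg hq₀ hq (inv_ne_zero hx), thetaReg, thetaReg,
    div_inv_eq_mul, mul_comm q x, inv_mul_eq_div]
  field_simp
  ring

lemma thetaReg_ne_zero (hq : ‖q‖ < 1) (hx : x ∈ annulus q) : thetaReg q x ≠ 0 := by
  refine mul_ne_zero (eulerE_ne_zero hq) (mul_ne_zero ?_ ?_)
  · exact qPochhammerInf_ne_zero_of_norm_lt_one hq (by rw [norm_mul, mul_comm]; exact hx.2)
  · refine qPochhammerInf_ne_zero_of_norm_lt_one hq ?_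
    rw [norm_div, div_lt_one (norm_pos_of_mem_annulus hx)]
    exact hx.1

lemma theta_ne_zero (hq₀ : q ≠ 0) (hq : ‖q‖ < 1) (hx : x ∈ annulus q) (hx₁ : x ≠ 1) :
    theta x q ≠ 0 := by
  rw [theta_eq_thetaReg hq₀ hq (ne_zero_of_mem_annulus hx)]
  exact mul_ne_zero (sub_ne_zero.mpr hx₁.symm) (thetaReg_ne_zero hq hx)

/-- The Weierstrass `℘`-function of the torus `ℂˣ / q^ℤ` in the multiplicative coordinate, up to
an additive constant. -/
noncomputable def weierstrassP (q x : ℂ) : ℂ := x / (1 - x) ^ 2 + lambertSum q x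

lemma weierstrassP_eq (hq₀ : q ≠ 0) (hq : ‖q‖ < 1) (hx : x ∈ annulus q) (hx₁ : x ≠ 1) :
    weierstrassP q x = thetaHess q x / theta x q ^ 2 := by
  have hreg := thetaReg_ne_zero hq hx
  have hx' : 1 - x ≠ 0 := sub_ne_zero.mpr hx₁.symm
  rw [weierstrassP, thetaHess_eq hq₀ hq hx, theta_eq_thetaReg hq₀ hq (ne_zero_of_mem_annulus hx)]
  field_simp

lemma weierstrassP_sub (hq₀ : q ≠ 0) (hq : ‖q‖ < 1) (hx : x ∈ annulus q) (hx₁ : x ≠ 1)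
    (hy : y ∈ annulus q) (hy₁ : y ≠ 1) :
    weierstrassP q x - weierstrassP q y =
      -eulerE q ^ 6 * (y * (theta (x * y) q * theta (x / y) q)) /
        (theta x q * theta y q) ^ 2 := by
  have hθx := theta_ne_zero hq₀ hq hx hx₁
  have hθy := theta_ne_zero hq₀ hq hy hy₁
  rw [weierstrassP_eq hq₀ hq hx hx₁, weierstrassP_eq hq₀ hq hy hy₁,
    ← thetaHess_mul_sub hq₀ hq (ne_zero_of_mem_annulus hx) (ne_zero_of_mem_annulus hy)]
  field_simp

lemma weierstrassP_sub_sq (hq₀ : q ≠ 0) (hq : ‖q‖ < 1) (hx : x ∈ annulus q) (hx₁ : x ≠ 1)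
    (hy : x ^ 2 ∈ annulus q) (hy₁ : x ^ 2 ≠ 1) :
    weierstrassP q x - weierstrassP q (x ^ 2) =
      eulerE q ^ 6 * (x * theta (x ^ 3) q) / (theta x q * theta (x ^ 2) q ^ 2) := by
  have hx₀ := ne_zero_of_mem_annulus hx
  have hθx := theta_ne_zero hq₀ hq hx hx₁
  have hθy := theta_ne_zero hq₀ hq hy hy₁
  have hinv : theta (x / x ^ 2) q = -x⁻¹ * theta x q := by
    rw [← theta_inv hq₀ hq hx₀, sq, div_mul_cancel_left₀ hx₀]
  rw [weierstrassP_sub hq₀ hq hx hx₁ hy hy₁, hinv, ← pow_succ']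
  field_simp

end Weierstrass

/-! ### Lambert series -/

section Lambert

variable {q x : ℂ}

lemma hasSum_pnat_iff_nat {f : ℕ → ℂ} (hf : f 0 = 0) {a : ℂ} :
    HasSum (fun n : ℕ+ => f n) a ↔ HasSum f a := by
  rw [hasSum_pnat_iff, hf, add_zero]

lemma hasSum_pnat_mul_pow (hx : ‖x‖ < 1) :
    HasSum (fun k : ℕ+ => (k : ℂ) * x ^ (k : ℕ)) (x / (1 - x) ^ 2) :=
  (hasSum_pnat_iff_nat (f := fun k => (k : ℂ) * x ^ k) (by simp)).mpr
    (hasSum_coe_mul_geometric_of_norm_lt_one hx)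

lemma tsum_pnat_pow (hx : ‖x‖ < 1) : ∑' m : ℕ+, x ^ (m : ℕ) = x / (1 - x) := by
  rw [tsum_pnat_eq_tsum_succ (f := fun m => x ^ m)]
  simp only [pow_succ', tsum_mul_left, tsum_geometric_of_norm_lt_one hx, div_eq_mul_inv]

lemma hasSum_lambertSum (hq : ‖q‖ < 1) (hx : x ∈ annulus q) :
    HasSum (fun k : ℕ+ => (k : ℂ) * q ^ (k : ℕ) / (1 - q ^ (k : ℕ)) *
      (x ^ (k : ℕ) + x⁻¹ ^ (k : ℕ))) (lambertSum q x) := by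
  have hs : Summable fun k : ℤ => (k.natAbs * q ^ k.natAbs / (1 - q ^ k.natAbs) * x ^ k : ℂ) := by
    obtain ⟨z, hz, rfl⟩ := exists_exp_eq_of_mem_annulus hx
    have hU := isOpen_logAnnulus q
    refine (((laurentSummable_logCoeff hq).intCast_mul hU).intCast_mul hU z hz).congr fun k => ?_
    rw [natAbs_mul_pow_div hq, Complex.exp_int_mul]
  have := hs.hasSum.nat_add_neg
  simp only [Int.natAbs_neg, Int.natAbs_natCast, zpow_neg, zpow_natCast, ← mul_add,
    ← inv_pow] at this
  rw [← hasSum_pnat_iff_nat (by simp)] at this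
  simpa [lambertSum] using this

lemma hasSum_weierstrassP (hq : ‖q‖ < 1) (hx : x ∈ annulus q) (hx₁ : ‖x‖ < 1) :
    HasSum (fun k : ℕ+ => (k : ℂ) * (x ^ (k : ℕ) + q ^ (k : ℕ) / (1 - q ^ (k : ℕ)) *
      (x ^ (k : ℕ) + x⁻¹ ^ (k : ℕ)))) (weierstrassP q x) :=
  ((hasSum_pnat_mul_pow hx₁).add (hasSum_lambertSum hq hx)).congr_fun fun k => by ring

lemma hasSum_arithmeticFunction_mul {f g : ArithmeticFunction ℤ} {d : ℕ}
    (hf : ∀ n, ‖(f n : ℂ)‖ ≤ (n : ℝ) ^ d) (hg : ∀ n, ‖(g n : ℂ)‖ ≤ 1) (hq : ‖q‖ < 1) :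
    HasSum (fun n : ℕ+ => ((f * g) n : ℂ) * q ^ (n : ℕ))
      (∑' k : ℕ+, (f k : ℂ) * ∑' m : ℕ+, (g m : ℂ) * (q ^ (k : ℕ)) ^ (m : ℕ)) := by
  have hs : Summable fun c : ℕ+ × ℕ+ =>
      (f c.1 : ℂ) * ((g c.2 : ℂ) * (q ^ (c.1 : ℕ)) ^ (c.2 : ℕ)) := by
    refine Summable.of_norm_bounded ((Equiv.prodComm ℕ+ ℕ+).summable_iff.mpr
      (summable_prod_mul_pow (𝕜 := ℝ) d (r := ‖q‖) (by simpa using hq))) ?_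
    rintro ⟨k, m⟩
    simp only [Function.comp_apply, Equiv.prodComm_apply, Prod.swap_prod_mk]
    rw [norm_mul, norm_mul, ← pow_mul, norm_pow, mul_comm (m : ℕ)]
    calc ‖(f k : ℂ)‖ * (‖(g m : ℂ)‖ * ‖q‖ ^ ((k : ℕ) * m))
        ≤ (k : ℝ) ^ d * (1 * ‖q‖ ^ ((k : ℕ) * m)) := by
          gcongr
          · exact hf k
          · exact hg m
      _ = _ := by rw [one_mul]
  have hsum := sigmaAntidiagonalEquivProd.hasSum_iff.mpr hs.hasSum
  rw [hs.tsum_prod] at hsum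
  simp only [tsum_mul_left] at hsum
  refine hsum.sigma fun n => ?_
  have hterm (c : (n : ℕ).divisorsAntidiagonal) :
      (f c.1.1 : ℂ) * (g c.1.2 * (q ^ c.1.1) ^ c.1.2) = f c.1.1 * g c.1.2 * q ^ (n : ℕ) := by
    rw [← pow_mul, (Nat.mem_divisorsAntidiagonal.mp c.2).1, mul_assoc]
  rw [ArithmeticFunction.mul_apply, Int.cast_sum, Finset.sum_mul, ← Finset.sum_attach,
    ← Finset.univ_eq_attach]
  simp only [Int.cast_mul, ← hterm]
  exact hasSum_fintype _

end Lambert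

/-! ### The quadratic character modulo `5` -/

open scoped NumberTheorySymbols in
/-- The quadratic character modulo `5`. -/
def chiFive : ArithmeticFunction ℤ := ⟨fun n => J(n | 5), jacobiSym.zero_left (by norm_num)⟩

/-- The divisor sum `n ↦ ∑_{d ∣ n} d χ(n / d)`. -/
def sigmaQuot : ArithmeticFunction ℤ := (ArithmeticFunction.id : ArithmeticFunction ℤ) * chiFive

/-- The divisor sum `n ↦ ∑_{d ∣ n} χ(d) d`. -/
def sigmaTwist : ArithmeticFunction ℤ :=
  chiFive.pmul (ArithmeticFunction.id : ArithmeticFunction ℤ) *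
    (ArithmeticFunction.zeta : ArithmeticFunction ℤ)

/-- The quadratic Gauss sum `∑ χ(k) ζ^k` modulo `5`, for a fifth root of unity `ζ`. -/
def quinticGaussSum (ζ : ℂ) : ℂ := ζ - ζ ^ 2 - ζ ^ 3 + ζ ^ 4

section QuadraticCharacter

variable {q x ζ : ℂ}

lemma chiFive_mul (m n : ℕ) : chiFive (m * n) = chiFive m * chiFive n := by
  simp only [chiFive, ArithmeticFunction.coe_mk, Nat.cast_mul, jacobiSym.mul_left]

lemma chiFive_pow (m k : ℕ) : chiFive (m ^ k) = chiFive m ^ k := by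
  simp only [chiFive, ArithmeticFunction.coe_mk, Nat.cast_pow, jacobiSym.pow_left]

lemma chiFive_mod (n : ℕ) : chiFive (n % 5) = chiFive n := by
  simp only [chiFive, ArithmeticFunction.coe_mk, Int.natCast_mod]
  exact (jacobiSym.mod_left n 5).symm

lemma chiFive_one : chiFive 1 = 1 := by norm_num [chiFive]

lemma chiFive_two : chiFive 2 = -1 := by norm_num [chiFive]

lemma chiFive_three : chiFive 3 = -1 := by norm_num [chiFive]

lemma chiFive_four : chiFive 4 = 1 := by norm_num [chiFive]

lemma chiFive_five : chiFive 5 = 0 := by norm_num [chiFive]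

lemma norm_chiFive_le (n : ℕ) : ‖(chiFive n : ℂ)‖ ≤ 1 := by
  rcases jacobiSym.trichotomy n 5 with h | h | h <;> simp [chiFive, h]

lemma tsum_chiFive_mul_pow (hx : ‖x‖ < 1) :
    ∑' m : ℕ+, (chiFive m : ℂ) * x ^ (m : ℕ) = (x - x ^ 2 - x ^ 3 + x ^ 4) / (1 - x ^ 5) := by
  have hs : Summable fun m : ℕ => (chiFive m : ℂ) * x ^ m := by
    refine Summable.of_norm_bounded (summable_geometric_of_lt_one (norm_nonneg x) hx) fun m => ?_
    rw [norm_mul, norm_pow]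
    exact mul_le_of_le_one_left (by positivity) (norm_chiFive_le m)
  have hperiod : ∑' m : ℕ, (chiFive (m + 5) : ℂ) * x ^ (m + 5) =
      x ^ 5 * ∑' m : ℕ, (chiFive m : ℂ) * x ^ m := by
    rw [← tsum_mul_left]
    refine tsum_congr fun m => ?_
    rw [← chiFive_mod (m + 5), Nat.add_mod_right, chiFive_mod]
    ring
  have hsum := hs.sum_add_tsum_nat_add 5
  rw [hperiod] at hsum
  simp only [Finset.sum_range_succ, Finset.sum_range_zero, ArithmeticFunction.map_zero,
    chiFive_one, chiFive_two, chiFive_three, chiFive_four] at hsum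
  push_cast at hsum
  rw [((hasSum_pnat_iff_nat (by simp)).mpr hs.hasSum).tsum_eq,
    eq_div_iff (one_sub_pow_ne_zero hx (by norm_num))]
  linear_combination -hsum

lemma quintic_sum_eq_zero (hζ : IsPrimitiveRoot ζ 5) : 1 + ζ + ζ ^ 2 + ζ ^ 3 + ζ ^ 4 = 0 := by
  simpa [Finset.sum_range_succ] using hζ.geom_sum_eq_zero (by norm_num)

lemma quintic_inv_pow (hζ : IsPrimitiveRoot ζ 5) {m n : ℕ} (h : m + n = 5) :
    (ζ ^ m)⁻¹ = ζ ^ n :=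
  inv_eq_of_mul_eq_one_right (by rw [← pow_add, h, hζ.pow_eq_one])

lemma pow_add_inv_pow_sub (hζ : IsPrimitiveRoot ζ 5) (k : ℕ) :
    ζ ^ k + ζ⁻¹ ^ k - ((ζ ^ 2) ^ k + (ζ ^ 2)⁻¹ ^ k) = chiFive k * quinticGaussSum ζ := by
  have hmod (m : ℕ) : (ζ ^ m) ^ k = (ζ ^ m) ^ (k % 5) := by
    conv_lhs => rw [← Nat.div_add_mod k 5, pow_add, pow_mul, pow_right_comm ζ m,
      hζ.pow_eq_one, one_pow, one_pow, one_mul]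
  have hsum := quintic_sum_eq_zero hζ
  rw [← pow_one ζ, quintic_inv_pow hζ (n := 4) (by norm_num), pow_one ζ,
    quintic_inv_pow hζ (n := 3) (by norm_num), ← pow_one ζ, hmod, pow_one ζ, hmod, hmod, hmod,
    ← chiFive_mod k, quinticGaussSum]
  have hk := Nat.mod_lt k (show 0 < 5 by norm_num)
  interval_cases k % 5 <;>
    simp only [ArithmeticFunction.map_zero, chiFive_one, chiFive_two, chiFive_three, chiFive_four]
    <;> grind

lemma quinticGaussSum_sq (hζ : IsPrimitiveRoot ζ 5) : quinticGaussSum ζ ^ 2 = 5 := by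
  have := quintic_sum_eq_zero hζ
  grind [quinticGaussSum]

lemma quinticGaussSum_ne_zero (hζ : IsPrimitiveRoot ζ 5) : quinticGaussSum ζ ≠ 0 := by
  intro h
  simpa [h] using quinticGaussSum_sq hζ

lemma quinticGaussSum_mul (hζ : IsPrimitiveRoot ζ 5) :
    quinticGaussSum ζ * (ζ * ((1 - ζ) * (1 - ζ ^ 2))) = 5 := by
  have := quintic_sum_eq_zero hζ
  grind [quinticGaussSum]

lemma div_one_sub_sq_sub_div (hζ : IsPrimitiveRoot ζ 5) :
    ζ / (1 - ζ) ^ 2 - ζ ^ 2 / (1 - ζ ^ 2) ^ 2 = -(quinticGaussSum ζ / 5) := by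
  have hsum := quintic_sum_eq_zero hζ
  have hζ₁ : 1 - ζ ≠ 0 := sub_ne_zero.mpr (hζ.ne_one (by norm_num)).symm
  have hζ₂ : 1 - ζ ^ 2 ≠ 0 :=
    sub_ne_zero.mpr (hζ.pow_ne_one_of_pos_of_lt (by norm_num) (by norm_num)).symm
  have hpoly : 5 * (ζ * (1 - ζ ^ 2) ^ 2 - ζ ^ 2 * (1 - ζ) ^ 2) =
      -quinticGaussSum ζ * ((1 - ζ) ^ 2 * (1 - ζ ^ 2) ^ 2) := by
    grind [quinticGaussSum]
  field_simp
  linear_combination hpoly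

end QuadraticCharacter

/-! ### The Lambert series of the eta quotients -/

section EtaQuotients

variable {q ζ : ℂ}

lemma ne_one_of_norm_lt_one (hq : ‖q‖ < 1) : q ≠ 1 := by
  rintro rfl
  exact hq.ne norm_one

lemma theta_mul_theta_pow_five (hq₀ : q ≠ 0) (hq : ‖q‖ < 1) :
    theta q (q ^ 5) * theta (q ^ 2) (q ^ 5) = eulerE (q ^ 5) * eulerE q := by
  have hres := qPochhammerInf_eq_prod_residues q hq 5
  simp only [Fin.prod_univ_five, Fin.coe_ofNat_eq_mod, Nat.reduceMod, ← pow_succ',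
    Nat.reduceAdd, pow_one] at hres
  rw [theta_eq_prod (pow_ne_zero 5 hq₀) (norm_pow_lt_one hq (by norm_num)) hq₀,
    theta_eq_prod (pow_ne_zero 5 hq₀) (norm_pow_lt_one hq (by norm_num)) (pow_ne_zero 2 hq₀),
    show q ^ 5 / q = q ^ 4 by field_simp, show q ^ 5 / q ^ 2 = q ^ 3 by field_simp,
    eulerE.eq_def q, hres, eulerE]
  ring

lemma weierstrassP_pow_five_sub (hq₀ : q ≠ 0) (hq : ‖q‖ < 1) :
    weierstrassP (q ^ 5) q - weierstrassP (q ^ 5) (q ^ 2) =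
      q * (eulerE (q ^ 5) ^ 5 / eulerE q) := by
  have hq₅ : q ^ 5 ≠ 0 := pow_ne_zero 5 hq₀
  have hq₅' : ‖q ^ 5‖ < 1 := norm_pow_lt_one hq (by norm_num)
  have hmem₁ : q ∈ annulus (q ^ 5) := by simpa using pow_mem_annulus hq₀ hq (show 1 < 5 by norm_num)
  have hmem₂ : q ^ 2 ∈ annulus (q ^ 5) := pow_mem_annulus hq₀ hq (by norm_num)
  have hne₁ : q ≠ 1 := ne_one_of_norm_lt_one hq
  have hne₂ : q ^ 2 ≠ 1 := ne_one_of_norm_lt_one (norm_pow_lt_one hq (by norm_num))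
  have hθ₁ := theta_ne_zero hq₅ hq₅' hmem₁ hne₁
  have hθ₂ := theta_ne_zero hq₅ hq₅' hmem₂ hne₂
  have hθ₃ : theta (q ^ 3) (q ^ 5) = theta (q ^ 2) (q ^ 5) := by
    rw [← theta_div_self hq₅ hq₅' (pow_ne_zero 2 hq₀)]
    congr 1
    field_simp
  have hE₁ := eulerE_ne_zero hq
  have hE₅ := eulerE_ne_zero hq₅'
  calc weierstrassP (q ^ 5) q - weierstrassP (q ^ 5) (q ^ 2)
      = q * eulerE (q ^ 5) ^ 6 / (theta q (q ^ 5) * theta (q ^ 2) (q ^ 5)) := by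
        rw [weierstrassP_sub_sq hq₅ hq₅' hmem₁ hne₁ hmem₂ hne₂, hθ₃]
        field_simp
    _ = q * (eulerE (q ^ 5) ^ 5 / eulerE q) := by
        rw [theta_mul_theta_pow_five hq₀ hq]
        field_simp

lemma hasSum_sigmaQuot (hq : ‖q‖ < 1) :
    HasSum (fun n : ℕ+ => (sigmaQuot n : ℂ) * q ^ (n : ℕ))
      (q * (eulerE (q ^ 5) ^ 5 / eulerE q)) := by
  rcases eq_or_ne q 0 with rfl | hq₀
  · simp
  have hq₂ : ‖q ^ 2‖ < 1 := norm_pow_lt_one hq (by norm_num)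
  have hq₅ : ‖q ^ 5‖ < 1 := norm_pow_lt_one hq (by norm_num)
  have hP₁ := hasSum_weierstrassP hq₅ (by simpa using pow_mem_annulus hq₀ hq (m := 1) (by simp)) hq
  have hP₂ := hasSum_weierstrassP hq₅ (pow_mem_annulus hq₀ hq (m := 2) (by simp)) hq₂
  have hsum := hasSum_arithmeticFunction_mul (f := (ArithmeticFunction.id : ArithmeticFunction ℤ))
    (d := 1) (fun n => by simp) norm_chiFive_le hq
  convert! hsum using 1
  rw [← weierstrassP_pow_five_sub hq₀ hq, ← (hP₁.sub hP₂).tsum_eq]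
  refine tsum_congr fun k => ?_
  have hk : ‖q ^ (k : ℕ)‖ < 1 := norm_pow_lt_one hq k.ne_zero
  have hx₀ : q ^ (k : ℕ) ≠ 0 := pow_ne_zero _ hq₀
  have h5 := one_sub_pow_ne_zero hk (k := 5) (by norm_num)
  rw [tsum_chiFive_mul_pow hk, inv_pow, inv_pow, pow_right_comm q 5, pow_right_comm q 2]
  simp only [ArithmeticFunction.natCoe_apply, ArithmeticFunction.id_apply, Int.cast_natCast]
  generalize q ^ (k : ℕ) = x at *
  field_simp
  ring

lemma theta_mul_theta_quintic (hζ : IsPrimitiveRoot ζ 5) (hq₀ : q ≠ 0) (hq : ‖q‖ < 1) :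
    theta ζ q * theta (ζ ^ 2) q = (1 - ζ) * (1 - ζ ^ 2) * (eulerE q * eulerE (q ^ 5)) := by
  have hζ₀ : ζ ≠ 0 := hζ.ne_zero (by norm_num)
  have hroots := prod_qPochhammerInf_rootsOfUnity hζ (by norm_num) q hq
  simp only [Finset.prod_range_succ, Finset.prod_range_zero, pow_zero, pow_one, one_mul] at hroots
  rw [theta_eq_thetaReg hq₀ hq hζ₀, theta_eq_thetaReg hq₀ hq (pow_ne_zero 2 hζ₀), thetaReg,
    thetaReg, div_eq_mul_inv, div_eq_mul_inv, quintic_inv_pow hζ (n := 3) (by norm_num),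
    ← pow_one ζ⁻¹, inv_pow, quintic_inv_pow hζ (n := 4) (by norm_num), mul_comm q (ζ ^ 3),
    mul_comm q (ζ ^ 4), eulerE.eq_def (q ^ 5), ← hroots, eulerE]
  ring

lemma weierstrassP_quintic_sub (hζ : IsPrimitiveRoot ζ 5) (hq₀ : q ≠ 0) (hq : ‖q‖ < 1) :
    weierstrassP q ζ - weierstrassP q (ζ ^ 2) =
      -(quinticGaussSum ζ / 5 * (eulerE q ^ 5 / eulerE (q ^ 5))) := by
  have hζ₀ : ζ ≠ 0 := hζ.ne_zero (by norm_num)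
  have hζ₁ : ζ ≠ 1 := hζ.ne_one (by norm_num)
  have hζ₂ : ζ ^ 2 ≠ 1 := hζ.pow_ne_one_of_pos_of_lt (by norm_num) (by norm_num)
  have hnorm : ‖ζ‖ = 1 := hζ.norm'_eq_one (by norm_num)
  have hmem₁ : ζ ∈ annulus q := mem_annulus_of_norm_eq_one hq hnorm
  have hmem₂ : ζ ^ 2 ∈ annulus q := mem_annulus_of_norm_eq_one hq (by simp [hnorm])
  have hθ₁ := theta_ne_zero hq₀ hq hmem₁ hζ₁
  have hθ₂ := theta_ne_zero hq₀ hq hmem₂ hζ₂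
  have hθ₃ : theta (ζ ^ 3) q = -(ζ ^ 2)⁻¹ * theta (ζ ^ 2) q := by
    rw [← theta_inv hq₀ hq (pow_ne_zero 2 hζ₀), quintic_inv_pow hζ (n := 3) (by norm_num)]
  have hζ₁' : 1 - ζ ≠ 0 := sub_ne_zero.mpr hζ₁.symm
  have hζ₂' : 1 - ζ ^ 2 ≠ 0 := sub_ne_zero.mpr hζ₂.symm
  have hE₁ := eulerE_ne_zero hq
  have hE₅ := eulerE_pow_ne_zero hq (k := 5) (by norm_num)
  calc weierstrassP q ζ - weierstrassP q (ζ ^ 2)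
      = -(eulerE q ^ 6 / (ζ * (theta ζ q * theta (ζ ^ 2) q))) := by
        rw [weierstrassP_sub_sq hq₀ hq hmem₁ hζ₁ hmem₂ hζ₂, hθ₃]
        field_simp
    _ = -(quinticGaussSum ζ / 5 * (eulerE q ^ 5 / eulerE (q ^ 5))) := by
        rw [theta_mul_theta_quintic hζ hq₀ hq]
        field_simp
        linear_combination quinticGaussSum_mul hζ

lemma lambertSum_quintic_sub (hζ : IsPrimitiveRoot ζ 5) (hq₀ : q ≠ 0) (hq : ‖q‖ < 1) :
    lambertSum q ζ - lambertSum q (ζ ^ 2) =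
      quinticGaussSum ζ * ((1 - eulerE q ^ 5 / eulerE (q ^ 5)) / 5) := by
  have h := weierstrassP_quintic_sub hζ hq₀ hq
  rw [weierstrassP, weierstrassP] at h
  linear_combination h - div_one_sub_sq_sub_div hζ

lemma hasSum_sigmaTwist (hq : ‖q‖ < 1) :
    HasSum (fun n : ℕ+ => (sigmaTwist n : ℂ) * q ^ (n : ℕ))
      ((1 - eulerE q ^ 5 / eulerE (q ^ 5)) / 5) := by
  rcases eq_or_ne q 0 with rfl | hq₀
  · simp [eulerE_zero]
  have hζ := Complex.isPrimitiveRoot_exp 5 (by norm_num)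
  set ζ := Complex.exp (2 * Real.pi * Complex.I / (5 : ℕ))
  have hnorm : ‖ζ‖ = 1 := hζ.norm'_eq_one (by norm_num)
  have hL₁ := hasSum_lambertSum hq (mem_annulus_of_norm_eq_one hq hnorm)
  have hL₂ := hasSum_lambertSum hq (mem_annulus_of_norm_eq_one hq (x := ζ ^ 2) (by simp [hnorm]))
  have hG := quinticGaussSum_ne_zero hζ
  have hsum := hasSum_arithmeticFunction_mul (d := 1)
    (f := chiFive.pmul (ArithmeticFunction.id : ArithmeticFunction ℤ))
    (g := (ArithmeticFunction.zeta : ArithmeticFunction ℤ))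
    (fun n => by
      simpa using mul_le_of_le_one_left (Nat.cast_nonneg n) (norm_chiFive_le n))
    (fun n => by by_cases h : n = 0 <;> simp [h]) hq
  convert! hsum using 1
  refine mul_left_cancel₀ hG ?_
  rw [← lambertSum_quintic_sub hζ hq₀ hq, ← (hL₁.sub hL₂).tsum_eq, ← tsum_mul_left]
  refine tsum_congr fun k => ?_
  rw [← mul_sub, pow_add_inv_pow_sub hζ]
  have hone (m : ℕ+) : ((ArithmeticFunction.zeta : ArithmeticFunction ℤ) m : ℂ) = 1 := by simp
  simp only [hone, one_mul, tsum_pnat_pow (norm_pow_lt_one hq k.ne_zero)]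
  simp only [ArithmeticFunction.pmul_apply, ArithmeticFunction.natCoe_apply,
    ArithmeticFunction.id_apply, Int.cast_mul, Int.cast_natCast]
  ring

end EtaQuotients

/-! ### The arithmetic of the divisor sums -/

section DivisorSums

variable {m n p : ℕ}

lemma isMultiplicative_chiFive : chiFive.IsMultiplicative :=
  ⟨chiFive_one, fun {m n} _ => chiFive_mul m n⟩

lemma isMultiplicative_sigmaQuot : sigmaQuot.IsMultiplicative :=
  ArithmeticFunction.isMultiplicative_id.natCast.mul isMultiplicative_chiFive

lemma isMultiplicative_sigmaTwist : sigmaTwist.IsMultiplicative :=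
  (isMultiplicative_chiFive.pmul ArithmeticFunction.isMultiplicative_id.natCast).mul
    ArithmeticFunction.isMultiplicative_zeta.natCast

lemma sigmaTwist_prime_pow (hp : p.Prime) (v : ℕ) :
    sigmaTwist (p ^ v) = ∑ i ∈ Finset.range (v + 1), (chiFive p * p) ^ i := by
  rw [sigmaTwist, ArithmeticFunction.coe_mul_zeta_apply, Nat.sum_divisors_prime_pow hp]
  refine Finset.sum_congr rfl fun i _ => ?_
  simp only [ArithmeticFunction.pmul_apply, ArithmeticFunction.natCoe_apply,
    ArithmeticFunction.id_apply, chiFive_pow, Nat.cast_pow, mul_pow]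

lemma sigmaQuot_prime_pow (hp : p.Prime) (v : ℕ) :
    sigmaQuot (p ^ v) = ∑ i ∈ Finset.range (v + 1), (p : ℤ) ^ i * chiFive p ^ (v - i) := by
  rw [sigmaQuot, ArithmeticFunction.mul_apply,
    Nat.sum_divisorsAntidiagonal (fun i j =>
      (ArithmeticFunction.id : ArithmeticFunction ℤ) i * chiFive j),
    Nat.sum_divisors_prime_pow hp]
  refine Finset.sum_congr rfl fun i hi => ?_
  rw [Nat.pow_div (Finset.mem_range_succ_iff.mp hi) hp.pos, chiFive_pow,
    ArithmeticFunction.natCoe_apply, ArithmeticFunction.id_apply, Nat.cast_pow]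

lemma sigmaQuot_prime_pow_eq (hp : p.Prime) (hχ : chiFive p ^ 2 = 1) (v : ℕ) :
    sigmaQuot (p ^ v) = chiFive p ^ v * sigmaTwist (p ^ v) := by
  rw [sigmaQuot_prime_pow hp, sigmaTwist_prime_pow hp, Finset.mul_sum]
  refine Finset.sum_congr rfl fun i hi => ?_
  obtain ⟨j, rfl⟩ := Nat.exists_eq_add_of_le (Finset.mem_range_succ_iff.mp hi)
  have hsq : chiFive p ^ i * chiFive p ^ i = 1 := by
    rw [← pow_add, ← two_mul, pow_mul, hχ, one_pow]
  rw [Nat.add_sub_cancel_left, mul_pow, pow_add]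
  linear_combination (-chiFive p ^ j * (p : ℤ) ^ i) * hsq

lemma sigmaQuot_five_pow (v : ℕ) : sigmaQuot (5 ^ v) = 5 ^ v := by
  rw [sigmaQuot_prime_pow Nat.prime_five, chiFive_five, Finset.sum_range_succ,
    Finset.sum_eq_zero fun i hi => ?_]
  · simp
  · rw [zero_pow (Nat.sub_ne_zero_of_lt (Finset.mem_range.mp hi)), mul_zero]

lemma sigmaTwist_five_pow (v : ℕ) : sigmaTwist (5 ^ v) = 1 := by
  rw [sigmaTwist_prime_pow Nat.prime_five, chiFive_five, zero_mul, Finset.sum_range_succ',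
    Finset.sum_eq_zero fun i _ => zero_pow (Nat.succ_ne_zero i), zero_add, pow_zero]

lemma sigmaTwist_two_pow (v : ℕ) : (sigmaTwist (2 ^ v) : ℂ) = (1 - (-2) ^ (v + 1)) / 3 := by
  rw [sigmaTwist_prime_pow Nat.prime_two, chiFive_two]
  push_cast
  rw [geom_sum_eq (by norm_num), ← neg_div_neg_eq]
  norm_num

lemma chiFive_of_mem_primesOne (hp : p ∈ primesOne n) : chiFive p = 1 := by
  rw [← chiFive_mod]
  rcases (Finset.mem_filter.mp hp).2 with h | h <;> rw [h]
  exacts [chiFive_one, chiFive_four]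

lemma chiFive_of_mem_primesTwo (hp : p ∈ primesTwo n) : chiFive p = -1 := by
  rw [← chiFive_mod]
  rcases (Finset.mem_filter.mp hp).2.2 with h | h <;> rw [h]
  exacts [chiFive_two, chiFive_three]

lemma prime_of_mem_primesOne (hp : p ∈ primesOne n) : p.Prime :=
  Nat.prime_of_mem_primeFactors (Finset.mem_filter.mp hp).1

lemma prime_of_mem_primesTwo (hp : p ∈ primesTwo n) : p.Prime :=
  Nat.prime_of_mem_primeFactors (Finset.mem_filter.mp hp).1

lemma primeFactors_subset_insert (n : ℕ) :
    n.primeFactors ⊆ insert 2 (insert 5 (primesOne n ∪ primesTwo n)) := by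
  intro p hp
  have hfive : 5 ∣ p → p = 5 := fun h =>
    ((Nat.prime_dvd_prime_iff_eq Nat.prime_five (Nat.prime_of_mem_primeFactors hp)).mp h).symm
  simp only [Finset.mem_insert, Finset.mem_union, primesOne, primesTwo, Finset.mem_filter, hp,
    true_and]
  omega

lemma prod_primeFactors_eq {M : Type*} [CommMonoid M] (n : ℕ) (f : ℕ → ℕ → M)
    (hf : ∀ p, f p 0 = 1) :
    ∏ p ∈ n.primeFactors, f p (n.factorization p) =
      f 2 (n.factorization 2) * f 5 (n.factorization 5) *
        ((∏ p ∈ primesOne n, f p (n.factorization p)) *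
          ∏ p ∈ primesTwo n, f p (n.factorization p)) := by
  have hdisj : Disjoint (primesOne n) (primesTwo n) :=
    Finset.disjoint_filter.mpr fun p _ h => by omega
  have h5 : 5 ∉ primesOne n ∪ primesTwo n := by simp [primesOne, primesTwo]
  have h2 : 2 ∉ insert 5 (primesOne n ∪ primesTwo n) := by simp [primesOne, primesTwo]
  rw [← Finset.prod_union hdisj, mul_assoc,
    ← Finset.prod_insert (f := fun p => f p (n.factorization p)) h5,
    ← Finset.prod_insert (f := fun p => f p (n.factorization p)) h2]
  refine Finset.prod_subset (primeFactors_subset_insert n) fun p _ hp => ?_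
  rw [← Nat.support_factorization, Finsupp.notMem_support_iff] at hp
  rw [hp, hf]

lemma apply_eq_prod_of_isMultiplicative {f : ArithmeticFunction ℤ} (hf : f.IsMultiplicative)
    (hn : n ≠ 0) :
    f n = f (2 ^ n.factorization 2) * f (5 ^ n.factorization 5) *
      ((∏ p ∈ primesOne n, f (p ^ n.factorization p)) *
        ∏ p ∈ primesTwo n, f (p ^ n.factorization p)) := by
  rw [← prod_primeFactors_eq n (fun p v => f (p ^ v)) fun p => by rw [pow_zero, hf.map_one]]
  exact hf.multiplicative_factorization f hn

lemma prod_sigmaTwist_eq_primesProd (n : ℕ) :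
    (∏ p ∈ primesOne n, (sigmaTwist (p ^ n.factorization p) : ℂ)) *
      ∏ p ∈ primesTwo n, (sigmaTwist (p ^ n.factorization p) : ℂ) = primesProd n := by
  rw [primesProd]
  congr 1 <;> refine Finset.prod_congr rfl fun p hp => ?_
  · have hprime := prime_of_mem_primesOne hp
    have hne : (p : ℂ) ≠ 1 := by exact_mod_cast hprime.one_lt.ne'
    rw [sigmaTwist_prime_pow hprime, chiFive_of_mem_primesOne hp]
    push_cast
    rw [one_mul, geom_sum_eq hne, ← neg_div_neg_eq, neg_sub, neg_sub]
  · have hne : -(p : ℂ) ≠ 1 := fun h => by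
      have : (p : ℂ) + 1 = 0 := by linear_combination -h
      norm_cast at this
    rw [sigmaTwist_prime_pow (prime_of_mem_primesTwo hp), chiFive_of_mem_primesTwo hp]
    push_cast
    rw [neg_one_mul, geom_sum_eq hne, ← neg_div_neg_eq, neg_sub, neg_sub, sub_neg_eq_add]

lemma sigmaTwist_eq_primesProd (hn : n ≠ 0) :
    (sigmaTwist n : ℂ) = (1 - (-2) ^ (n.factorization 2 + 1)) / 3 * primesProd n := by
  rw [apply_eq_prod_of_isMultiplicative isMultiplicative_sigmaTwist hn]
  push_cast
  rw [prod_sigmaTwist_eq_primesProd, sigmaTwist_two_pow, sigmaTwist_five_pow, Int.cast_one, mul_one]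

/-- The factor `5^h (-1)^(g + t)` of the coefficient formulas, which relates the two divisor
sums `sigmaQuot` and `sigmaTwist`. -/
def twistFactor (n : ℕ) : ℤ :=
  5 ^ n.factorization 5 * (-1) ^ (n.factorization 2 + primesTwoOmega n)

lemma sigmaQuot_eq_twistFactor_mul (hn : n ≠ 0) :
    sigmaQuot n = twistFactor n * sigmaTwist n := by
  have hprodOne : ∏ p ∈ primesOne n, sigmaQuot (p ^ n.factorization p) =
      ∏ p ∈ primesOne n, sigmaTwist (p ^ n.factorization p) :=
    Finset.prod_congr rfl fun p hp => by
      have hχ := chiFive_of_mem_primesOne hp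
      rw [sigmaQuot_prime_pow_eq (prime_of_mem_primesOne hp) (by rw [hχ, one_pow]), hχ, one_pow,
        one_mul]
  have hprodTwo : ∏ p ∈ primesTwo n, sigmaQuot (p ^ n.factorization p) =
      (-1) ^ primesTwoOmega n * ∏ p ∈ primesTwo n, sigmaTwist (p ^ n.factorization p) := by
    rw [primesTwoOmega, ← Finset.prod_pow_eq_pow_sum, ← Finset.prod_mul_distrib]
    refine Finset.prod_congr rfl fun p hp => ?_
    have hχ := chiFive_of_mem_primesTwo hp
    rw [sigmaQuot_prime_pow_eq (prime_of_mem_primesTwo hp) (by rw [hχ, neg_one_sq]), hχ]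
  rw [apply_eq_prod_of_isMultiplicative isMultiplicative_sigmaQuot hn,
    apply_eq_prod_of_isMultiplicative isMultiplicative_sigmaTwist hn,
    hprodOne, hprodTwo, sigmaQuot_five_pow, sigmaTwist_five_pow,
    sigmaQuot_prime_pow_eq Nat.prime_two (by rw [chiFive_two, neg_one_sq]), chiFive_two,
    twistFactor, pow_add]
  ring

lemma filter_primeFactors_two_mul (hm : m ≠ 0) (P : ℕ → Prop) [DecidablePred P] (hP : ¬P 2) :
    (2 * m).primeFactors.filter P = m.primeFactors.filter P := by
  rw [Nat.primeFactors_mul two_ne_zero hm, Nat.prime_two.primeFactors, Finset.filter_union,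
    Finset.filter_singleton, if_neg hP, Finset.empty_union]

lemma factorization_two_mul (hm : m ≠ 0) (hp : p ≠ 2) :
    (2 * m).factorization p = m.factorization p := by
  rw [Nat.factorization_mul two_ne_zero hm, Finsupp.add_apply, Nat.prime_two.factorization,
    Finsupp.single_eq_of_ne hp, zero_add]

lemma factorization_two_mul_self (hm : m ≠ 0) :
    (2 * m).factorization 2 = m.factorization 2 + 1 := by
  rw [Nat.factorization_mul two_ne_zero hm, Finsupp.add_apply, Nat.prime_two.factorization,
    Finsupp.single_eq_same, add_comm]

lemma primesOne_two_mul (hm : m ≠ 0) : primesOne (2 * m) = primesOne m :=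
  filter_primeFactors_two_mul hm _ (by norm_num)

lemma primesTwo_two_mul (hm : m ≠ 0) : primesTwo (2 * m) = primesTwo m :=
  filter_primeFactors_two_mul hm _ (by norm_num)

lemma ne_two_of_mem_primesOne (hp : p ∈ primesOne n) : p ≠ 2 := by
  rintro rfl
  simp [primesOne] at hp

lemma ne_two_of_mem_primesTwo (hp : p ∈ primesTwo n) : p ≠ 2 :=
  (Finset.mem_filter.mp hp).2.1

lemma primesTwoOmega_two_mul (hm : m ≠ 0) : primesTwoOmega (2 * m) = primesTwoOmega m := by
  rw [primesTwoOmega, primesTwo_two_mul hm]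
  exact Finset.sum_congr rfl fun p hp => factorization_two_mul hm (ne_two_of_mem_primesTwo hp)

lemma primesProd_two_mul (hm : m ≠ 0) : primesProd (2 * m) = primesProd m := by
  rw [primesProd, primesOne_two_mul hm, primesTwo_two_mul hm, primesProd]
  congr 1 <;> refine Finset.prod_congr rfl fun p hp => ?_
  · rw [factorization_two_mul hm (ne_two_of_mem_primesOne hp)]
  · rw [factorization_two_mul hm (ne_two_of_mem_primesTwo hp)]

lemma twistFactor_two_mul (hm : m ≠ 0) : twistFactor (2 * m) = -twistFactor m := by
  rw [twistFactor, twistFactor, factorization_two_mul hm (by norm_num),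
    factorization_two_mul_self hm, primesTwoOmega_two_mul hm]
  ring

/-- The coefficients of `f(q²)`, where `f` is the power series with the given coefficients. -/
def halfCoeff (f : ℕ → ℤ) (n : ℕ) : ℤ := if 2 ∣ n then f (n / 2) else 0

lemma halfCoeff_two_mul (f : ℕ → ℤ) (m : ℕ) : halfCoeff f (2 * m) = f m := by
  rw [halfCoeff, if_pos (dvd_mul_right 2 m), Nat.mul_div_cancel_left m two_pos]

lemma halfCoeff_of_not_dvd (f : ℕ → ℤ) (h : ¬2 ∣ n) : halfCoeff f n = 0 := if_neg h

lemma halfCoeff_sigmaTwist (hn : n ≠ 0) :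
    (halfCoeff sigmaTwist n : ℂ) = (1 - (-2) ^ n.factorization 2) / 3 * primesProd n := by
  by_cases h : 2 ∣ n
  · obtain ⟨m, rfl⟩ := h
    have hm : m ≠ 0 := right_ne_zero_of_mul hn
    rw [halfCoeff_two_mul, sigmaTwist_eq_primesProd hm, primesProd_two_mul hm,
      factorization_two_mul_self hm]
  · rw [halfCoeff_of_not_dvd _ h, Nat.factorization_eq_zero_of_not_dvd h]
    simp

lemma halfCoeff_sigmaQuot (hn : n ≠ 0) :
    halfCoeff sigmaQuot n = -twistFactor n * halfCoeff sigmaTwist n := by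
  by_cases h : 2 ∣ n
  · obtain ⟨m, rfl⟩ := h
    have hm : m ≠ 0 := right_ne_zero_of_mul hn
    rw [halfCoeff_two_mul, halfCoeff_two_mul, sigmaQuot_eq_twistFactor_mul hm,
      twistFactor_two_mul hm, neg_neg]
  · rw [halfCoeff_of_not_dvd _ h, halfCoeff_of_not_dvd _ h, mul_zero]

end DivisorSums

/-! ### Counting representations -/

section Counting

variable {q : ℂ}

lemma hasSum_mul_prod {ι κ : Type*} {f : ι → ℂ} {g : κ → ℂ} {a b : ℂ} (hf : HasSum f a)
    (hg : HasSum g b) : HasSum (fun p : ι × κ => f p.1 * g p.2) (a * b) :=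
  hf.mul hg (summable_mul_of_summable_norm hf.summable.norm hg.summable.norm)

lemma hasSum_ncard_mul_pow {ι : Type*} (N : ι → ℕ) {a : ℂ} (h : HasSum (fun i => q ^ N i) a) :
    HasSum (fun n : ℕ => ({i | N i = n}.ncard : ℂ) * q ^ n) a := by
  have hfiber := (Equiv.sigmaFiberEquiv N).hasSum_iff.mpr h
  refine (hfiber.sigma fun n => (hfiber.summable.sigma_factor n).hasSum).congr_fun fun n => ?_
  have hconst (c : {i // N i = n}) :
      ((fun i => q ^ N i) ∘ Equiv.sigmaFiberEquiv N) ⟨n, c⟩ = q ^ n := by simp [c.2]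
  simp only [hconst, tsum_const, nsmul_eq_mul]
  rfl

lemma hasSum_ramanujanPhi (hq : ‖q‖ < 1) :
    HasSum (fun n : ℤ => q ^ n.natAbs ^ 2) (ramanujanPhi q) := by
  rcases eq_or_ne q 0 with rfl | hq₀
  · rw [ramanujanPhi_zero]
    convert! hasSum_single (f := fun n : ℤ => (0 : ℂ) ^ n.natAbs ^ 2) 0 fun n hn => by simp [hn]
  · rw [ramanujanPhi_eq_thetaPow hq₀]
    refine (summable_norm_thetaPow hq₀ hq two_ne_zero 1).of_norm.hasSum.congr_fun fun n => ?_
    have hexp : ((2 : ℕ) * tri n + 1 * n : ℤ) = ((n.natAbs ^ 2 : ℕ) : ℤ) := by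
      push_cast
      rw [sq_abs]
      linarith [two_mul_tri n]
    rw [hexp, zpow_natCast]

lemma two_mul_ramanujanPsi (hq₀ : q ≠ 0) (hq : ‖q‖ < 1) :
    2 * ramanujanPsi q = thetaPow q 1 1 := by
  rw [ramanujanPsi_eq_prod hq, ← thetaPow_one_zero hq₀ hq, ← thetaPow_sub hq₀ 1 1]
  norm_num

lemma natCast_mul_add_one_div_two (k : ℕ) : ((k * (k + 1) / 2 : ℕ) : ℤ) = tri k + k := by
  rw [← mul_add_one_ediv_two]
  norm_cast

lemma hasSum_ramanujanPsi (hq : ‖q‖ < 1) :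
    HasSum (fun k : ℕ => q ^ (k * (k + 1) / 2)) (ramanujanPsi q) := by
  rcases eq_or_ne q 0 with rfl | hq₀
  · rw [ramanujanPsi_zero]
    have hzero (k : ℕ) (hk : k ≠ 0) : (0 : ℂ) ^ (k * (k + 1) / 2) = 0 :=
      zero_pow (Nat.div_pos (by nlinarith [Nat.pos_of_ne_zero hk]) two_pos).ne'
    simpa using hasSum_single (f := fun k : ℕ => (0 : ℂ) ^ (k * (k + 1) / 2)) 0 hzero
  · have hsum := (summable_norm_thetaPow hq₀ hq one_ne_zero 1).of_norm.hasSum.nat_add_neg_add_one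
    rw [← thetaPow, ← two_mul_ramanujanPsi hq₀ hq] at hsum
    convert! hsum.mul_left (1 / 2) using 1
    · funext k
      have hneg : tri (-(k + 1)) = tri k + 2 * k + 1 := by
        linarith [two_mul_tri (-((k : ℤ) + 1)), two_mul_tri k]
      rw [← zpow_natCast, natCast_mul_add_one_div_two, hneg]
      ring_nf
    · ring

lemma quaternaryCount_eq (k l n : ℕ) :
    quaternaryCount k l n = {v : ℤ × ℤ × ℤ × ℤ | k * v.1.natAbs ^ 2 + l *
      (v.2.1.natAbs ^ 2 + v.2.2.1.natAbs ^ 2 + v.2.2.2.natAbs ^ 2) = n}.ncard := by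
  unfold quaternaryCount
  congr 1
  ext v
  simp only [Set.mem_ofPred_eq]
  rw [← Int.natCast_inj]
  push_cast
  simp only [sq_abs]

lemma hasSum_quaternaryCount {k l : ℕ} (hk : k ≠ 0) (hl : l ≠ 0) (hq : ‖q‖ < 1) :
    HasSum (fun n : ℕ => (quaternaryCount k l n : ℂ) * q ^ n)
      (ramanujanPhi (q ^ k) * ramanujanPhi (q ^ l) ^ 3) := by
  have hφk := hasSum_ramanujanPhi (norm_pow_lt_one hq hk)
  have hφl := hasSum_ramanujanPhi (norm_pow_lt_one hq hl)
  have hprod := hasSum_mul_prod hφk (hasSum_mul_prod hφl (hasSum_mul_prod hφl hφl))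
  simp only [quaternaryCount_eq]
  refine hasSum_ncard_mul_pow _ ?_
  convert! hprod using 1
  · funext v
    ring
  · ring

lemma quaternaryCount_zero {k l : ℕ} (hk : k ≠ 0) (hl : l ≠ 0) :
    quaternaryCount k l (0 : ℕ) = 1 := by
  rw [quaternaryCount_eq, Set.ncard_eq_one]
  refine ⟨0, ?_⟩
  ext ⟨x, y, z, w⟩
  simp [hk, hl, and_assoc]

lemma triangular_injective : Function.Injective fun k : ℕ => k * (k + 1) / 2 := by
  refine (strictMono_nat_of_lt_succ fun k => ?_).injective
  rw [show (k + 1) * (k + 1 + 1) = k * (k + 1) + 2 * (k + 1) by ring,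
    Nat.add_mul_div_left _ _ two_pos]
  omega

lemma triangularCount_eq (k l s n : ℕ) :
    triangularCount k l s n = {v : ℕ × ℕ × ℕ × ℕ | k * (v.1 * (v.1 + 1) / 2) + l *
      (v.2.1 * (v.2.1 + 1) / 2 + v.2.2.1 * (v.2.2.1 + 1) / 2 +
        v.2.2.2 * (v.2.2.2 + 1) / 2) + s = n}.ncard := by
  have hinj := triangular_injective
  rw [← Set.ncard_image_of_injective _ (hinj.prodMap (hinj.prodMap (hinj.prodMap hinj)))]
  unfold triangularCount
  congr 1
  ext ⟨x, y, z, w⟩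
  simp only [Set.mem_ofPred_eq, Set.mem_image, Prod.exists, Prod.map_apply, Prod.mk.injEq,
    IsTriangularNumber]
  constructor
  · rintro ⟨⟨a, rfl⟩, ⟨b, rfl⟩, ⟨c, rfl⟩, ⟨d, rfl⟩, h⟩
    exact ⟨a, b, c, d, h, rfl, rfl, rfl, rfl⟩
  · rintro ⟨a, b, c, d, h, rfl, rfl, rfl, rfl⟩
    exact ⟨⟨a, rfl⟩, ⟨b, rfl⟩, ⟨c, rfl⟩, ⟨d, rfl⟩, h⟩

lemma hasSum_triangularCount {k l : ℕ} (hk : k ≠ 0) (hl : l ≠ 0) (s : ℕ) (hq : ‖q‖ < 1) :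
    HasSum (fun n : ℕ => (triangularCount k l s n : ℂ) * q ^ n)
      (q ^ s * (ramanujanPsi (q ^ k) * ramanujanPsi (q ^ l) ^ 3)) := by
  have hψk := hasSum_ramanujanPsi (norm_pow_lt_one hq hk)
  have hψl := hasSum_ramanujanPsi (norm_pow_lt_one hq hl)
  have hprod := (hasSum_mul_prod hψk
    (hasSum_mul_prod hψl (hasSum_mul_prod hψl hψl))).mul_left (q ^ s)
  simp only [triangularCount_eq]
  refine hasSum_ncard_mul_pow _ ?_
  convert! hprod using 1
  · funext v
    simp only [pow_add, pow_mul]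
    ring
  · ring

lemma triangularCount_zero (k l : ℕ) {s : ℕ} (hs : s ≠ 0) : triangularCount k l s 0 = 0 := by
  rw [triangularCount_eq]
  simp [hs]

lemma hasSum_quaternaryCount_pnat {k l : ℕ} (hk : k ≠ 0) (hl : l ≠ 0) (hq : ‖q‖ < 1) :
    HasSum (fun n : ℕ+ => (quaternaryCount k l n : ℂ) * q ^ (n : ℕ))
      (ramanujanPhi (q ^ k) * ramanujanPhi (q ^ l) ^ 3 - 1) := by
  rw [hasSum_pnat_iff (f := fun n : ℕ => (quaternaryCount k l n : ℂ) * q ^ n),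
    quaternaryCount_zero hk hl, Nat.cast_one, pow_zero, mul_one, sub_add_cancel]
  exact hasSum_quaternaryCount hk hl hq

lemma hasSum_triangularCount_pnat {k l s : ℕ} (hk : k ≠ 0) (hl : l ≠ 0) (hs : s ≠ 0)
    (hq : ‖q‖ < 1) :
    HasSum (fun n : ℕ+ => 4 * (triangularCount k l s n : ℂ) * q ^ (n : ℕ))
      (4 * (q ^ s * (ramanujanPsi (q ^ k) * ramanujanPsi (q ^ l) ^ 3))) := by
  have hsum := (hasSum_triangularCount hk hl s hq).mul_left 4
  rw [← hasSum_pnat_iff_nat (by simp [triangularCount_zero k l hs])] at hsum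
  exact hsum.congr_fun fun n => mul_assoc _ _ _

lemma hasSum_representationCounts (hq : ‖q‖ < 1) :
    HasSum (fun n : ℕ+ => (quaternaryCount 1 5 n : ℂ) * q ^ (n : ℕ))
      (ramanujanPhi q * ramanujanPhi (q ^ 5) ^ 3 - 1) ∧
    HasSum (fun n : ℕ+ => (quaternaryCount 5 1 n : ℂ) * q ^ (n : ℕ))
      (ramanujanPhi q ^ 3 * ramanujanPhi (q ^ 5) - 1) ∧
    HasSum (fun n : ℕ+ => 4 * (triangularCount 5 1 1 n : ℂ) * q ^ (n : ℕ))
      (4 * q * ramanujanPsi q ^ 3 * ramanujanPsi (q ^ 5)) ∧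
    HasSum (fun n : ℕ+ => 4 * (triangularCount 1 5 2 n : ℂ) * q ^ (n : ℕ))
      (4 * q ^ 2 * ramanujanPsi q * ramanujanPsi (q ^ 5) ^ 3) := by
  have h5 : 5 ≠ 0 := by norm_num
  refine ⟨?_, ?_, ?_, ?_⟩
  · simpa using hasSum_quaternaryCount_pnat one_ne_zero h5 hq
  · simpa [mul_comm] using hasSum_quaternaryCount_pnat h5 one_ne_zero hq
  · convert! hasSum_triangularCount_pnat h5 one_ne_zero one_ne_zero hq using 1
    ring_nf
  · convert! hasSum_triangularCount_pnat one_ne_zero h5 two_ne_zero hq using 1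
    ring_nf

end Counting

/-! ### The coefficient formulas -/

section Coefficients

variable {q : ℂ}

lemma eq_of_hasSum_mul_pow {𝕜 : Type*} [NontriviallyNormedField 𝕜] {a b : ℕ → 𝕜} {f : 𝕜 → 𝕜}
    (ha : ∀ᶠ x in 𝓝 0, HasSum (fun n => a n * x ^ n) (f x))
    (hb : ∀ᶠ x in 𝓝 0, HasSum (fun n => b n * x ^ n) (f x)) : a = b := by
  have hseries {c : ℕ → 𝕜} (hc : ∀ᶠ x in 𝓝 0, HasSum (fun n => c n * x ^ n) (f x)) :
      HasFPowerSeriesAt f (FormalMultilinearSeries.ofScalars 𝕜 c) 0 := by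
    simpa [hasFPowerSeriesAt_iff, FormalMultilinearSeries.coeff_ofScalars, mul_comm] using hc
  funext n
  have heq := (hseries ha).eq_formalMultilinearSeries (hseries hb)
  rw [← FormalMultilinearSeries.coeff_ofScalars (𝕜 := 𝕜) (p := a), heq,
    FormalMultilinearSeries.coeff_ofScalars]

lemma eq_of_hasSum_pnat_mul_pow {a b : ℕ+ → ℂ} {f : ℂ → ℂ}
    (ha : ∀ q : ℂ, ‖q‖ < 1 → HasSum (fun n : ℕ+ => a n * q ^ (n : ℕ)) (f q))
    (hb : ∀ q : ℂ, ‖q‖ < 1 → HasSum (fun n : ℕ+ => b n * q ^ (n : ℕ)) (f q)) (n : ℕ+) :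
    a n = b n := by
  have hextend {c : ℕ+ → ℂ}
      (hc : ∀ q : ℂ, ‖q‖ < 1 → HasSum (fun n : ℕ+ => c n * q ^ (n : ℕ)) (f q)) :
      ∀ᶠ q in 𝓝 (0 : ℂ), HasSum (fun n : ℕ => Function.extend PNat.val c 0 n * q ^ n) (f q) := by
    filter_upwards [Metric.ball_mem_nhds 0 one_pos] with q hq
    rw [← hasSum_pnat_iff_nat
      (by rw [Function.extend_apply' _ _ _ (by simp), Pi.zero_apply, zero_mul])]
    simpa only [PNat.coe_injective.extend_apply] using hc q (mem_ball_zero_iff.mp hq)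
  have hcoeff := congrFun (eq_of_hasSum_mul_pow (hextend ha) (hextend hb)) n
  rwa [PNat.coe_injective.extend_apply, PNat.coe_injective.extend_apply] at hcoeff

lemma hasSum_halfCoeff {f : ℕ → ℤ} {a : ℂ}
    (h : HasSum (fun n : ℕ+ => (f n : ℂ) * (q ^ 2) ^ (n : ℕ)) a) :
    HasSum (fun n : ℕ+ => (halfCoeff f n : ℂ) * q ^ (n : ℕ)) a := by
  have hinj : Function.Injective fun n : ℕ+ => 2 * n := mul_right_injective 2
  refine (hinj.hasSum_iff fun n hn => ?_).mp (h.congr_fun fun n => ?_)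
  · have hodd : ¬2 ∣ (n : ℕ) := fun ⟨m, hm⟩ =>
      hn ⟨⟨m, Nat.pos_of_mul_pos_left (hm ▸ n.pos)⟩, PNat.eq hm.symm⟩
    rw [halfCoeff_of_not_dvd _ hodd, Int.cast_zero, zero_mul]
  · rw [Function.comp_apply, PNat.mul_coe, PNat.val_ofNat, halfCoeff_two_mul, pow_mul]

lemma hasSum_halfCoeff_sigmaTwist (hq : ‖q‖ < 1) :
    HasSum (fun n : ℕ+ => (halfCoeff sigmaTwist n : ℂ) * q ^ (n : ℕ))
      ((1 - eulerE (q ^ 2) ^ 5 / eulerE (q ^ 10)) / 5) := by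
  have h := hasSum_halfCoeff (hasSum_sigmaTwist (norm_pow_lt_one hq two_ne_zero))
  rwa [← pow_mul] at h

lemma hasSum_halfCoeff_sigmaQuot (hq : ‖q‖ < 1) :
    HasSum (fun n : ℕ+ => (halfCoeff sigmaQuot n : ℂ) * q ^ (n : ℕ))
      (q ^ 2 * (eulerE (q ^ 10) ^ 5 / eulerE (q ^ 2))) := by
  have h := hasSum_halfCoeff (hasSum_sigmaQuot (norm_pow_lt_one hq two_ne_zero))
  rwa [← pow_mul] at h

lemma neg_one_pow_sub_one_mul_neg_pow (n : ℕ+) (q : ℂ) :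
    (-1) ^ ((n : ℕ) - 1) * (-q) ^ (n : ℕ) = -q ^ (n : ℕ) := by
  have hodd : Odd ((n : ℕ) - 1 + n) := ⟨n - 1, by have := n.pos; omega⟩
  rw [neg_pow q, ← mul_assoc, ← pow_add, hodd.neg_one_pow, neg_one_mul]

lemma hasSum_phi_combination (hq : ‖q‖ < 1) (r : ℂ) :
    HasSum (fun n : ℕ+ => (-1) ^ ((n : ℕ) - 1) * (1 + r * twistFactor n) *
        ((5 + (-2) ^ ((n : ℕ).factorization 2 + 1)) / 3) * primesProd n * (-q) ^ (n : ℕ))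
      ((eulerE q ^ 5 / eulerE (q ^ 5) + 4 * (eulerE (q ^ 2) ^ 5 / eulerE (q ^ 10))) / 5
          - r * (q * (eulerE (q ^ 5) ^ 5 / eulerE q)
              - 4 * q ^ 2 * (eulerE (q ^ 10) ^ 5 / eulerE (q ^ 2))) - 1) := by
  have hT := (hasSum_sigmaTwist hq).add ((hasSum_halfCoeff_sigmaTwist hq).mul_left 4)
  have hQ := (hasSum_sigmaQuot hq).sub ((hasSum_halfCoeff_sigmaQuot hq).mul_left 4)
  convert! hT.neg.sub (hQ.mul_left r) using 1
  · funext n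
    rw [halfCoeff_sigmaQuot n.ne_zero, sigmaQuot_eq_twistFactor_mul n.ne_zero]
    push_cast
    rw [halfCoeff_sigmaTwist n.ne_zero, sigmaTwist_eq_primesProd n.ne_zero]
    linear_combination (1 + r * twistFactor n) *
      ((5 + (-2) ^ ((n : ℕ).factorization 2 + 1)) / 3) * primesProd n *
      neg_one_pow_sub_one_mul_neg_pow n q
  · ring

lemma hasSum_psi_combination (hq : ‖q‖ < 1) (r : ℂ) :
    HasSum (fun n : ℕ+ => (-2) ^ (n : ℕ).factorization 2 * (-1 + r * twistFactor n) *
        primesProd n * q ^ (n : ℕ))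
      ((eulerE q ^ 5 / eulerE (q ^ 5) - eulerE (q ^ 2) ^ 5 / eulerE (q ^ 10)) / 5
          + r * (q * (eulerE (q ^ 5) ^ 5 / eulerE q)
              + q ^ 2 * (eulerE (q ^ 10) ^ 5 / eulerE (q ^ 2)))) := by
  have hT := (hasSum_halfCoeff_sigmaTwist hq).sub (hasSum_sigmaTwist hq)
  have hQ := (hasSum_sigmaQuot hq).add (hasSum_halfCoeff_sigmaQuot hq)
  convert! hT.add (hQ.mul_left r) using 1
  · funext n
    rw [halfCoeff_sigmaQuot n.ne_zero, sigmaQuot_eq_twistFactor_mul n.ne_zero]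
    push_cast
    rw [halfCoeff_sigmaTwist n.ne_zero, sigmaTwist_eq_primesProd n.ne_zero]
    ring
  · ring

lemma hasSum_phi_mul_phi_cube (hq : ‖q‖ < 1) :
    HasSum (fun n : ℕ+ => (-1) ^ ((n : ℕ) - 1) *
        (1 + 5 ^ (n : ℕ).factorization 5 *
          (-1) ^ ((n : ℕ).factorization 2 + primesTwoOmega n)) *
        ((5 + (-2) ^ ((n : ℕ).factorization 2 + 1)) / 3) * primesProd n * q ^ (n : ℕ))
      (ramanujanPhi q * ramanujanPhi (q ^ 5) ^ 3 - 1) := by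
  have hneg : ‖-q‖ < 1 := by rwa [norm_neg]
  have hθ := (theta_identities hneg).1
  have hsum := hasSum_phi_combination hneg 1
  rw [one_mul, ← hθ, neg_neg, Odd.neg_pow (by decide), neg_neg] at hsum
  refine hsum.congr_fun fun n => ?_
  rw [twistFactor]
  push_cast
  ring

lemma hasSum_phi_cube_mul_phi (hq : ‖q‖ < 1) :
    HasSum (fun n : ℕ+ => (-1) ^ ((n : ℕ) - 1) *
        (1 + 5 ^ ((n : ℕ).factorization 5 + 1) *
          (-1) ^ ((n : ℕ).factorization 2 + primesTwoOmega n)) *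
        ((5 + (-2) ^ ((n : ℕ).factorization 2 + 1)) / 3) * primesProd n * q ^ (n : ℕ))
      (ramanujanPhi q ^ 3 * ramanujanPhi (q ^ 5) - 1) := by
  have hneg : ‖-q‖ < 1 := by rwa [norm_neg]
  have hθ := (theta_identities hneg).2.1
  have hsum := hasSum_phi_combination hneg 5
  rw [← hθ, neg_neg, Odd.neg_pow (by decide), neg_neg] at hsum
  refine hsum.congr_fun fun n => ?_
  rw [twistFactor]
  push_cast
  ring

lemma hasSum_psi_cube_mul_psi (hq : ‖q‖ < 1) :
    HasSum (fun n : ℕ+ => (-2) ^ (n : ℕ).factorization 2 *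
        (-1 + 5 ^ ((n : ℕ).factorization 5 + 1) *
          (-1) ^ ((n : ℕ).factorization 2 + primesTwoOmega n)) * primesProd n * q ^ (n : ℕ))
      (4 * q * ramanujanPsi q ^ 3 * ramanujanPsi (q ^ 5)) := by
  have hsum := hasSum_psi_combination hq 5
  rw [← (theta_identities hq).2.2.1] at hsum
  refine hsum.congr_fun fun n => ?_
  rw [twistFactor]
  push_cast
  ring

lemma hasSum_psi_mul_psi_cube (hq : ‖q‖ < 1) :
    HasSum (fun n : ℕ+ => (-2) ^ (n : ℕ).factorization 2 *
        (-1 + 5 ^ (n : ℕ).factorization 5 *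
          (-1) ^ ((n : ℕ).factorization 2 + primesTwoOmega n)) * primesProd n * q ^ (n : ℕ))
      (4 * q ^ 2 * ramanujanPsi q * ramanujanPsi (q ^ 5) ^ 3) := by
  have hsum := hasSum_psi_combination hq 1
  rw [one_mul, ← (theta_identities hq).2.2.2] at hsum
  refine hsum.congr_fun fun n => ?_
  rw [twistFactor]
  push_cast
  ring

end Coefficients

theorem theorem7p1 :
    -- the four theta function identities
    (∀ q : ℂ, ‖q‖ < 1 →
      ramanujanPhi (-q) * ramanujanPhi (-q ^ 5) ^ 3 =
          (eulerE q ^ 5 / eulerE (q ^ 5) + 4 * (eulerE (q ^ 2) ^ 5 / eulerE (q ^ 10))) / 5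
          - (q * (eulerE (q ^ 5) ^ 5 / eulerE q)
              - 4 * q ^ 2 * (eulerE (q ^ 10) ^ 5 / eulerE (q ^ 2))) ∧
      ramanujanPhi (-q) ^ 3 * ramanujanPhi (-q ^ 5) =
          (eulerE q ^ 5 / eulerE (q ^ 5) + 4 * (eulerE (q ^ 2) ^ 5 / eulerE (q ^ 10))) / 5
          - 5 * (q * (eulerE (q ^ 5) ^ 5 / eulerE q)
              - 4 * q ^ 2 * (eulerE (q ^ 10) ^ 5 / eulerE (q ^ 2))) ∧
      4 * q * ramanujanPsi q ^ 3 * ramanujanPsi (q ^ 5) =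
          (eulerE q ^ 5 / eulerE (q ^ 5) - eulerE (q ^ 2) ^ 5 / eulerE (q ^ 10)) / 5
          + 5 * (q * (eulerE (q ^ 5) ^ 5 / eulerE q)
              + q ^ 2 * (eulerE (q ^ 10) ^ 5 / eulerE (q ^ 2))) ∧
      4 * q ^ 2 * ramanujanPsi q * ramanujanPsi (q ^ 5) ^ 3 =
          (eulerE q ^ 5 / eulerE (q ^ 5) - eulerE (q ^ 2) ^ 5 / eulerE (q ^ 10)) / 5
          + (q * (eulerE (q ^ 5) ^ 5 / eulerE q)
              + q ^ 2 * (eulerE (q ^ 10) ^ 5 / eulerE (q ^ 2)))) ∧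
    -- the power series expansions exist, and their coefficients count representations
    (∀ q : ℂ, ‖q‖ < 1 →
      HasSum (fun n : ℕ+ => (quaternaryCount 1 5 n : ℂ) * q ^ (n : ℕ))
        (ramanujanPhi q * ramanujanPhi (q ^ 5) ^ 3 - 1) ∧
      HasSum (fun n : ℕ+ => (quaternaryCount 5 1 n : ℂ) * q ^ (n : ℕ))
        (ramanujanPhi q ^ 3 * ramanujanPhi (q ^ 5) - 1) ∧
      HasSum (fun n : ℕ+ => 4 * (triangularCount 5 1 1 n : ℂ) * q ^ (n : ℕ))
        (4 * q * ramanujanPsi q ^ 3 * ramanujanPsi (q ^ 5)) ∧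
      HasSum (fun n : ℕ+ => 4 * (triangularCount 1 5 2 n : ℂ) * q ^ (n : ℕ))
        (4 * q ^ 2 * ramanujanPsi q * ramanujanPsi (q ^ 5) ^ 3)) ∧
    -- the formulas for the coefficients
    (∀ a : ℕ+ → ℂ,
      (∀ q : ℂ, ‖q‖ < 1 → HasSum (fun n : ℕ+ => a n * q ^ (n : ℕ))
        (ramanujanPhi q * ramanujanPhi (q ^ 5) ^ 3 - 1)) →
      ∀ n : ℕ+, a n =
        (-1) ^ ((n : ℕ) - 1)
          * (1 + 5 ^ (n : ℕ).factorization 5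
              * (-1) ^ ((n : ℕ).factorization 2 + primesTwoOmega n))
          * ((5 + (-2) ^ ((n : ℕ).factorization 2 + 1)) / 3) * primesProd n) ∧
    (∀ b : ℕ+ → ℂ,
      (∀ q : ℂ, ‖q‖ < 1 → HasSum (fun n : ℕ+ => b n * q ^ (n : ℕ))
        (ramanujanPhi q ^ 3 * ramanujanPhi (q ^ 5) - 1)) →
      ∀ n : ℕ+, b n =
        (-1) ^ ((n : ℕ) - 1)
          * (1 + 5 ^ ((n : ℕ).factorization 5 + 1)
              * (-1) ^ ((n : ℕ).factorization 2 + primesTwoOmega n))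
          * ((5 + (-2) ^ ((n : ℕ).factorization 2 + 1)) / 3) * primesProd n) ∧
    (∀ c : ℕ+ → ℂ,
      (∀ q : ℂ, ‖q‖ < 1 → HasSum (fun n : ℕ+ => c n * q ^ (n : ℕ))
        (4 * q * ramanujanPsi q ^ 3 * ramanujanPsi (q ^ 5))) →
      ∀ n : ℕ+, c n =
        (-2) ^ (n : ℕ).factorization 2
          * (-1 + 5 ^ ((n : ℕ).factorization 5 + 1)
              * (-1) ^ ((n : ℕ).factorization 2 + primesTwoOmega n))
          * primesProd n) ∧
    (∀ d : ℕ+ → ℂ,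
      (∀ q : ℂ, ‖q‖ < 1 → HasSum (fun n : ℕ+ => d n * q ^ (n : ℕ))
        (4 * q ^ 2 * ramanujanPsi q * ramanujanPsi (q ^ 5) ^ 3)) →
      ∀ n : ℕ+, d n =
        (-2) ^ (n : ℕ).factorization 2
          * (-1 + 5 ^ (n : ℕ).factorization 5
              * (-1) ^ ((n : ℕ).factorization 2 + primesTwoOmega n))
          * primesProd n) := by
  refine ⟨fun q hq => theta_identities hq, fun q hq => hasSum_representationCounts hq,
    fun a ha => eq_of_hasSum_pnat_mul_pow ha fun q hq => ?_,
    fun b hb => eq_of_hasSum_pnat_mul_pow hb fun q hq => ?_,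
    fun c hc => eq_of_hasSum_pnat_mul_pow hc fun q hq => ?_,
    fun d hd => eq_of_hasSum_pnat_mul_pow hd fun q hq => ?_⟩
  · exact hasSum_phi_mul_phi_cube hq
  · exact hasSum_phi_cube_mul_phi hq
  · exact hasSum_psi_cube_mul_psi hq
  · exact hasSum_psi_mul_psi_cube hq
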